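/- **Setting.** For $0<\rho_1\le\rho_2<\infty$ let $\mathfrak X_{\rho_1,\rho_2}$ be the class of probability distributions on $[0,1]$ that have a p.d.f. $g$ with $\rho_1\le g(x)\le\rho_2$ for all $x\in[0,1]$. A data set $\boldsymbol D=(D_1,\dots,D_n)\sim\chi$ consists of independent points, $D_i$ drawn from $\chi_i$, and $TV(\chi)=\max_{i,j}\|\chi_i-\chi_j\|_{TV}$ with $\|\mu-\nu\|_{TV}=\sup_A|\mu(A)-\nu(A)|$. The points are inserted one by one. A (learned) index is a data structure on a unit-cost word RAM with words of $c\cdot|n|_2$ bits, where $|n|_2$ is the binary length of $n$ and $c$ is a constant. The inserted points are kept in a read-only array in insertion order. Real numbers can only be compared, or be passed to a uniformly spaced piecewise model, which returns $\lfloor m(x-l)/(u-l)\rfloor$ for points (or query arguments, or $0$, $1$) $x,l,u$ and a word $m$. After any number $1\le k\le n$ of insertions, the index answers exactly every exact match query (return an item equal to $q\in[0,1]$, or nothing if there is none) and every range query (return all items in $[q,q']$, $q,q'\in[0,1]$), on every data set in $[0,1]^n$. For a constant $a$, let $T_I(\boldsymbol D)$ be the total number of operations of the $n$ insertions. Let $T_Q(\boldsymbol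 D)$ be the maximal number of operations of any query after any number $1\le k\le n$ of insertions, where $a$ operations per reported item are not counted for a range query. Let $S(\boldsymbol D)$ be the space overhead in bits (number of memory cells used times word length, excluding the array of data points). **Statement.** There is an absolute constant $C_0$ such that for all $0<\rho_1\le\rho_2<\infty$ there are a learned index and constants $c$, $a$ and $C$, depending only on $\rho_1,\rho_2$, with the following property. For all $n\ge 3$, all $\delta$, and all $\chi=\{\chi_1,\dots,\chi_n\}\subseteq\mathfrak X_{\rho_1,\rho_2}$ with $TV(\chi)\le\delta$, $$\tfrac1n\,\mathbb E_{\boldsymbol D\sim\chi}[T_I(\boldsymbol D)]\le C\bigl(\log\log n+\log^+(\delta\sqrt n)\bigr),\qquad \mathbb E_{\boldsymbol D\sim\chi}[T_Q(\boldsymbol D)]\le C\bigl(\log\log n+\log^+(\delta\sqrt n)\bigr),$$ $$\mathbb E_{\boldsymbol D\sim\chi}[S(\boldsymbol D)]\le C_0\,\frac{\rho_2}{\rho_1}\,n\log n,$$ where $\log^+ t=\max(0,\log t)$ for $t>0$ and $\log^+0=0$. -/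

import Mathlib

open MeasureTheory Set
open scoped ENNReal

noncomputable section

namespace LearnedIndex

/-! ### The machine

A word RAM with unit cost instructions.  Registers and memory cells hold natural numbers of `w`
bits; a computation that produces a larger number is stuck (it has no final state).  The data items
are real numbers, stored in insertion order in an array that can only be read.  A program can
compare two real operands, and it can compute in which of `m` uniformly spaced pieces of an interval
a real operand lies; it can neither store nor otherwise manipulate real numbers. -/

/-- Real operands: the data item whose index is in register `r`, the two query arguments, and the
end points of the data domain `[0, 1]`. -/
inductive RealOp where
  | item (r : ℕ)
  | lo
  | hi
  | zero
  | one

/-- Tests: comparison of two registers, and comparison of two real operands. -/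
inductive Test where
  | le (a b : ℕ)
  | realLe (x y : RealOp)

/-- Programs.  Letters `d a b m` are register numbers; `piece d x l u m` is
`d := ⌊m (x - l) / (u - l)⌋`; `emit a` appends register `a` to the output. -/
inductive Cmd where
  | skip
  | const (d v : ℕ)
  | add (d a b : ℕ)
  | sub (d a b : ℕ)
  | mul (d a b : ℕ)
  | div (d a b : ℕ)
  | load (d a : ℕ)
  | store (a b : ℕ)
  | piece (d : ℕ) (x l u : RealOp) (m : ℕ)
  | emit (a : ℕ)
  | seq (c₁ c₂ : Cmd)
  | cond (t : Test) (c₁ c₂ : Cmd)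
  | loop (t : Test) (c : Cmd)

/-- The real numbers a computation can see. -/
structure Env where
  item : ℕ → ℝ
  lo : ℝ
  hi : ℝ

/-- A machine state.  `time` counts executed instructions and tests, `cells` is the least number `S`
such that every memory cell accessed so far is among the cells `0, …, S - 1`. -/
structure State where
  reg : ℕ → ℕ
  mem : ℕ → ℕ
  out : List ℕ
  time : ℕ
  cells : ℕ

def RealOp.val (e : Env) (s : State) : RealOp → ℝ
  | .item r => e.item (s.reg r)
  | .lo => e.lo
  | .hi => e.hi
  | .zero => 0
  | .one => 1

def Test.holds (e : Env) (s : State) : Test → Prop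
  | .le a b => s.reg a ≤ s.reg b
  | .realLe x y => x.val e s ≤ y.val e s

/-- One time unit. -/
def State.tick (s : State) : State := { s with time := s.time + 1 }

/-- Access to memory cell `a`. -/
def State.touch (s : State) (a : ℕ) : State := { s with cells := max s.cells (a + 1) }

/-- Write `v` into register `d`. -/
def State.set (s : State) (d v : ℕ) : State := { s with reg := Function.update s.reg d v }

/-- `Exec w e c s s'`: with `w`-bit words and real inputs `e`, the program `c` started in the state
`s` halts in the state `s'`.  Subtraction is truncated, division is integer division. -/
inductive Exec (w : ℕ) (e : Env) : Cmd → State → State → Prop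
  | skip (s : State) : Exec w e .skip s s.tick
  | const (s : State) (d v : ℕ) (h : v < 2 ^ w) : Exec w e (.const d v) s (s.tick.set d v)
  | add (s : State) (d a b : ℕ) (h : s.reg a + s.reg b < 2 ^ w) :
      Exec w e (.add d a b) s (s.tick.set d (s.reg a + s.reg b))
  | sub (s : State) (d a b : ℕ) (h : s.reg a - s.reg b < 2 ^ w) :
      Exec w e (.sub d a b) s (s.tick.set d (s.reg a - s.reg b))
  | mul (s : State) (d a b : ℕ) (h : s.reg a * s.reg b < 2 ^ w) :
      Exec w e (.mul d a b) s (s.tick.set d (s.reg a * s.reg b))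
  | div (s : State) (d a b : ℕ) (h : s.reg a / s.reg b < 2 ^ w) :
      Exec w e (.div d a b) s (s.tick.set d (s.reg a / s.reg b))
  | load (s : State) (d a : ℕ) :
      Exec w e (.load d a) s ((s.tick.touch (s.reg a)).set d (s.mem (s.reg a)))
  | store (s : State) (a b : ℕ) :
      Exec w e (.store a b) s
        { s.tick.touch (s.reg a) with mem := Function.update s.mem (s.reg a) (s.reg b) }
  | piece (s : State) (d : ℕ) (x l u : RealOp) (m : ℕ)
      (h : ⌊(s.reg m : ℝ) * ((x.val e s - l.val e s) / (u.val e s - l.val e s))⌋₊ < 2 ^ w) :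
      Exec w e (.piece d x l u m) s (s.tick.set d
        ⌊(s.reg m : ℝ) * ((x.val e s - l.val e s) / (u.val e s - l.val e s))⌋₊)
  | emit (s : State) (a : ℕ) : Exec w e (.emit a) s { s.tick with out := s.out ++ [s.reg a] }
  | seq (c₁ c₂ : Cmd) (s s' s'' : State) (h₁ : Exec w e c₁ s s') (h₂ : Exec w e c₂ s' s'') :
      Exec w e (.seq c₁ c₂) s s''
  | cond_true (t : Test) (c₁ c₂ : Cmd) (s s' : State) (ht : t.holds e s)
      (h : Exec w e c₁ s.tick s') : Exec w e (.cond t c₁ c₂) s s'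
  | cond_false (t : Test) (c₁ c₂ : Cmd) (s s' : State) (ht : ¬ t.holds e s)
      (h : Exec w e c₂ s.tick s') : Exec w e (.cond t c₁ c₂) s s'
  | loop_done (t : Test) (c : Cmd) (s : State) (ht : ¬ t.holds e s) :
      Exec w e (.loop t c) s s.tick
  | loop_step (t : Test) (c : Cmd) (s s' s'' : State) (ht : t.holds e s)
      (h₁ : Exec w e c s.tick s') (h₂ : Exec w e (.loop t c) s' s'') :
      Exec w e (.loop t c) s s''

/-! ### Indexes -/

/-- An index: one program for insertions, one for exact match queries, one for range queries. -/
structure Index where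
  insert : Cmd
  find : Cmd
  range : Cmd

/-- The first `k` items of the data set `x` (later items are not visible) and two arguments. -/
def env {n : ℕ} (x : Fin n → ℝ) (k : ℕ) (lo hi : ℝ) : Env where
  item i := if h : i < n then (if i < k then x ⟨i, h⟩ else 0) else 0
  lo := lo
  hi := hi

/-- The memory before the first insertion. -/
def State.empty : State := ⟨fun _ => 0, fun _ => 0, [], 0, 0⟩

/-- Start of an operation: only the memory persists between operations; register `0` receives the
number `k` of data items, all other registers are `0`. -/
def State.start (s : State) (k : ℕ) : State :=
  { s with reg := fun r => if r = 0 then k else 0, out := [] }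

/-- As `State.start`, with the clock set to zero. -/
def State.startQuery (s : State) (k : ℕ) : State := { s.start k with time := 0 }

variable {n : ℕ}

/-- `I.Inserted w x k s`: `s` is the state after the first `k` items of `x` have been inserted one by
one; `s.time` is the total time of these insertions.  When the item `x k` is inserted, exactly the
items `x 0, …, x k` are visible. -/
def Index.Inserted (I : Index) (w : ℕ) (x : Fin n → ℝ) : ℕ → State → Prop
  | 0, s => s = State.empty
  | k + 1, s => ∃ s₀, I.Inserted w x k s₀ ∧ Exec w (env x (k + 1) 0 0) I.insert (s₀.start (k + 1)) s

/-- `s` is the final state of the exact match query `q` after `k` insertions. -/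
def Index.Found (I : Index) (w : ℕ) (x : Fin n → ℝ) (k : ℕ) (q : ℝ) (s : State) : Prop :=
  ∃ s₀, I.Inserted w x k s₀ ∧ Exec w (env x k q q) I.find (s₀.startQuery k) s

/-- `s` is the final state of the range query `[q, q']` after `k` insertions. -/
def Index.Ranged (I : Index) (w : ℕ) (x : Fin n → ℝ) (k : ℕ) (q q' : ℝ) (s : State) : Prop :=
  ∃ s₀, I.Inserted w x k s₀ ∧ Exec w (env x k q q') I.range (s₀.startQuery k) s

/-- With `w`-bit words, the index works on every data set `x` of `n` points of `[0, 1]`: every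
operation halts, queries leave the memory as it is, and their answers are exact.  Items are returned
by their position in `x`. An exact match query returns one item equal to `q`, or nothing if there is
none; a range query returns all items in `[q, q']`, each once. -/
def Index.Correct (I : Index) (w n : ℕ) : Prop :=
  ∀ x : Fin n → ℝ, (∀ i, x i ∈ Icc (0 : ℝ) 1) →
    ∀ k : ℕ, 1 ≤ k → k ≤ n → ∃ s₀, I.Inserted w x k s₀ ∧
      (∀ q ∈ Icc (0 : ℝ) 1, ∃ s, Exec w (env x k q q) I.find (s₀.startQuery k) s ∧
        s.mem = s₀.mem ∧
        ((∃ i : Fin n, (i : ℕ) < k ∧ x i = q ∧ s.out = [(i : ℕ)]) ∨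
          ((∀ i : Fin n, (i : ℕ) < k → x i ≠ q) ∧ s.out = []))) ∧
      (∀ q ∈ Icc (0 : ℝ) 1, ∀ q' ∈ Icc (0 : ℝ) 1,
        ∃ s, Exec w (env x k q q') I.range (s₀.startQuery k) s ∧
          s.mem = s₀.mem ∧ s.out.Nodup ∧
          ∀ j : ℕ, j ∈ s.out ↔ ∃ i : Fin n, (i : ℕ) = j ∧ j < k ∧ q ≤ x i ∧ x i ≤ q')

/-- The value of `f` at the final state `s` described by `R` (which is unique, since the machine is
deterministic), and `∞` if there is none. -/
def atEnd (R : State → Prop) (f : State → ℝ≥0∞) : ℝ≥0∞ := ⨅ (s : State) (_ : R s), f s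

/-- Total number of operations of the `n` insertions. -/
def Index.insertTime (I : Index) (w : ℕ) (x : Fin n → ℝ) : ℝ≥0∞ :=
  atEnd (I.Inserted w x n) fun s => s.time

/-- The largest number of operations of any query at any time, where a range query may spend `a`
additional operations per reported item. -/
def Index.queryTime (I : Index) (w a : ℕ) (x : Fin n → ℝ) : ℝ≥0∞ :=
  ⨆ k ∈ Icc 1 n, ⨆ q ∈ Icc (0 : ℝ) 1,
    max (atEnd (I.Found w x k q) fun s => s.time)
      (⨆ q' ∈ Icc (0 : ℝ) 1, atEnd (I.Ranged w x k q q') fun s => ((s.time - a * s.out.length : ℕ)))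

/-- Space overhead in bits: word length times the number of memory cells needed for the `n`
insertions and for all queries.  The array of data items is not counted. -/
def Index.space (I : Index) (w : ℕ) (x : Fin n → ℝ) : ℝ≥0∞ :=
  w * max (atEnd (I.Inserted w x n) fun s => s.cells)
    (⨆ k ∈ Icc 1 n, ⨆ q ∈ Icc (0 : ℝ) 1,
      max (atEnd (I.Found w x k q) fun s => s.cells)
        (⨆ q' ∈ Icc (0 : ℝ) 1, atEnd (I.Ranged w x k q q') fun s => s.cells))

/-! ### Distributions -/

/-- The distributions on `[0, 1]` with a probability density `g` with `ρ₁ ≤ g x ≤ ρ₂` for all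
`x ∈ [0, 1]`. -/
def boundedDensityClass (ρ₁ ρ₂ : ℝ) : Set (ProbabilityMeasure ℝ) :=
  {χ | ∃ g : ℝ → ℝ, Measurable g ∧ (∀ x ∈ Icc (0 : ℝ) 1, ρ₁ ≤ g x ∧ g x ≤ ρ₂) ∧
    (χ : Measure ℝ) = (volume.restrict (Icc (0 : ℝ) 1)).withDensity fun x => ENNReal.ofReal (g x)}

/-- Total variation distance `sup_A |μ(A) - ν(A)|` over measurable sets `A`. -/
def tvDist (μ ν : ProbabilityMeasure ℝ) : ℝ :=
  ⨆ A : {A : Set ℝ // MeasurableSet A}, |(μ : Measure ℝ).real A - (ν : Measure ℝ).real A|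

/-- Distribution shift: the largest total variation distance between two of the `χ i`. -/
def shift (χ : Fin n → ProbabilityMeasure ℝ) : ℝ := ⨆ p : Fin n × Fin n, tvDist (χ p.1) (χ p.2)

/-- The law of a data set whose `i`-th item is drawn independently from `χ i`. -/
def dataLaw (χ : Fin n → ProbabilityMeasure ℝ) : Measure (Fin n → ℝ) :=
  Measure.pi fun i => (χ i : Measure ℝ)

/-- Expectation of a nonnegative function; for a measurable `f` this is `∫⁻ x, f x ∂μ`, and in
general it is the outer expectation. -/
def expectation {Ω : Type*} [MeasurableSpace Ω] (μ : Measure Ω) (f : Ω → ℝ≥0∞) : ℝ≥0∞ :=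
  ⨅ (g : Ω → ℝ≥0∞) (_ : Measurable g) (_ : f ≤ g), ∫⁻ x, g x ∂μ

end LearnedIndex

end

/-!
The index cuts `[0, 1]` into `m` intervals of equal length (the buckets) and keeps the items of each
bucket in a sorted memory block.  The piecewise model finds the bucket of a real number in one
instruction.  When the number of items has reached `2 * m`, the structure is rebuilt, with as many
intervals as there are items, so that at all times `m ≤ k < 2 * m` for the number `k` of items.
Blocks grow by doubling, so the space is linear on every data set (`Rep.top_le`).  Every bucket
has a link to the next nonempty bucket.

An exact match query is a binary search in one bucket (`ends_findCmd`).  A range query is a binary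
search followed by a walk that uses the links, and so spends constant time per reported item
(`ends_rangeCmd`).  An insertion takes time linear in the number of items in the bucket, plus the
number of empty buckets immediately before it, whose links change (`ends_insertCmd`).

A density that is at most `ρ₂` gives a bucket at most the mass `ρ₂ / m`, and one that is at least
`ρ₁` gives `r` consecutive buckets at least the mass `ρ₁ * r / m`.  Since the items are independent,
all expectations reduce to products:
* the expected number of items in the bucket of a new item is `O(ρ₂ ^ 2)`
  (`lintegral_collisions_le`);
* `r` consecutive buckets are all empty with probability exponentially small in `ρ₁ * r`, so
  an expected constant number of links changes (`lintegral_gaps_le`);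
* if `L` is the number of items in a bucket, then `2 ^ L` has expectation at most `exp (2 * ρ₂)`
  (`lintegral_two_pow_load_le`).  Summed over all buckets and all times this is `O(n ^ 2)`, so the
  largest bucket has `O(log n)` items, and binary search takes time `O(log (log n))`.  The estimate
  `size_le` is linear in `2 ^ L`, so it can be integrated term by term.

Rebuilding is linear in expectation, and the sizes at which it happens at least double
(`sum_rebuild_le`).  The bucket limits do not depend on the distributions, so a distribution shift
does no harm: the bounds hold without the nonnegative term `log⁺ (δ * √n)`.
-/

namespace LearnedIndex

/-! ### Total correctness assertions -/

/-- The program `c`, started in `s`, halts in a state that satisfies `Q`. -/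
def Ends (w : ℕ) (e : Env) (c : Cmd) (s : State) (Q : State → Prop) : Prop :=
  ∃ s', Exec w e c s s' ∧ Q s'

section rules

variable {w : ℕ} {e : Env} {s : State} {Q R : State → Prop}

theorem Ends.mono {c : Cmd} (h : Ends w e c s Q) (hQ : ∀ s', Q s' → R s') : Ends w e c s R := by
  obtain ⟨s', h, h'⟩ := h
  exact ⟨s', h, hQ _ h'⟩

theorem ends_skip : Ends w e .skip s Q ↔ Q s.tick := by
  constructor
  · rintro ⟨s', h, hq⟩
    cases h
    exact hq
  · exact fun h => ⟨_, .skip s, h⟩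

theorem ends_const {d v : ℕ} :
    Ends w e (.const d v) s Q ↔ v < 2 ^ w ∧ Q (s.tick.set d v) := by
  constructor
  · rintro ⟨s', h, hq⟩
    cases h
    exact ⟨‹_›, hq⟩
  · exact fun h => ⟨_, .const s d v h.1, h.2⟩

theorem ends_add {d a b : ℕ} :
    Ends w e (.add d a b) s Q ↔
      s.reg a + s.reg b < 2 ^ w ∧ Q (s.tick.set d (s.reg a + s.reg b)) := by
  constructor
  · rintro ⟨s', h, hq⟩
    cases h
    exact ⟨‹_›, hq⟩
  · exact fun h => ⟨_, .add s d a b h.1, h.2⟩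

theorem ends_sub {d a b : ℕ} :
    Ends w e (.sub d a b) s Q ↔
      s.reg a - s.reg b < 2 ^ w ∧ Q (s.tick.set d (s.reg a - s.reg b)) := by
  constructor
  · rintro ⟨s', h, hq⟩
    cases h
    exact ⟨‹_›, hq⟩
  · exact fun h => ⟨_, .sub s d a b h.1, h.2⟩

theorem ends_mul {d a b : ℕ} :
    Ends w e (.mul d a b) s Q ↔
      s.reg a * s.reg b < 2 ^ w ∧ Q (s.tick.set d (s.reg a * s.reg b)) := by
  constructor
  · rintro ⟨s', h, hq⟩
    cases h
    exact ⟨‹_›, hq⟩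
  · exact fun h => ⟨_, .mul s d a b h.1, h.2⟩

theorem ends_div {d a b : ℕ} :
    Ends w e (.div d a b) s Q ↔
      s.reg a / s.reg b < 2 ^ w ∧ Q (s.tick.set d (s.reg a / s.reg b)) := by
  constructor
  · rintro ⟨s', h, hq⟩
    cases h
    exact ⟨‹_›, hq⟩
  · exact fun h => ⟨_, .div s d a b h.1, h.2⟩

theorem ends_load {d a : ℕ} :
    Ends w e (.load d a) s Q ↔ Q ((s.tick.touch (s.reg a)).set d (s.mem (s.reg a))) := by
  constructor
  · rintro ⟨s', h, hq⟩
    cases h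
    exact hq
  · exact fun h => ⟨_, .load s d a, h⟩

theorem ends_store {a b : ℕ} :
    Ends w e (.store a b) s Q ↔
      Q { s.tick.touch (s.reg a) with mem := Function.update s.mem (s.reg a) (s.reg b) } := by
  constructor
  · rintro ⟨s', h, hq⟩
    cases h
    exact hq
  · exact fun h => ⟨_, .store s a b, h⟩

theorem ends_piece {d m : ℕ} {x l u : RealOp} :
    Ends w e (.piece d x l u m) s Q ↔
      ⌊(s.reg m : ℝ) * ((x.val e s - l.val e s) / (u.val e s - l.val e s))⌋₊ < 2 ^ w ∧
      Q (s.tick.set d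
        ⌊(s.reg m : ℝ) * ((x.val e s - l.val e s) / (u.val e s - l.val e s))⌋₊) := by
  constructor
  · rintro ⟨s', h, hq⟩
    cases h
    exact ⟨‹_›, hq⟩
  · exact fun h => ⟨_, .piece s d x l u m h.1, h.2⟩

theorem ends_emit {a : ℕ} :
    Ends w e (.emit a) s Q ↔ Q { s.tick with out := s.out ++ [s.reg a] } := by
  constructor
  · rintro ⟨s', h, hq⟩
    cases h
    exact hq
  · exact fun h => ⟨_, .emit s a, h⟩

theorem ends_seq {c₁ c₂ : Cmd} :
    Ends w e (.seq c₁ c₂) s Q ↔ Ends w e c₁ s fun s' => Ends w e c₂ s' Q := by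
  constructor
  · rintro ⟨s', h, hq⟩
    cases h with
    | seq _ _ _ s₁ _ h₁ h₂ => exact ⟨s₁, h₁, _, h₂, hq⟩
  · rintro ⟨s₁, h₁, s₂, h₂, hq⟩
    exact ⟨s₂, .seq _ _ _ _ _ h₁ h₂, hq⟩

theorem ends_cond {t : Test} {c₁ c₂ : Cmd} :
    Ends w e (.cond t c₁ c₂) s Q ↔
      (t.holds e s → Ends w e c₁ s.tick Q) ∧ (¬ t.holds e s → Ends w e c₂ s.tick Q) := by
  constructor
  · rintro ⟨s', h, hq⟩
    cases h with
    | cond_true _ _ _ _ _ ht h => exact ⟨fun _ => ⟨_, h, hq⟩, fun h' => absurd ht h'⟩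
    | cond_false _ _ _ _ _ ht h => exact ⟨fun h' => absurd h' ht, fun _ => ⟨_, h, hq⟩⟩
  · rintro ⟨h₁, h₂⟩
    by_cases ht : t.holds e s
    · obtain ⟨s', h, hq⟩ := h₁ ht
      exact ⟨s', .cond_true _ _ _ _ _ ht h, hq⟩
    · obtain ⟨s', h, hq⟩ := h₂ ht
      exact ⟨s', .cond_false _ _ _ _ _ ht h, hq⟩

theorem ends_loop_of_not {t : Test} {c : Cmd} (ht : ¬ t.holds e s) (hq : Q s.tick) :
    Ends w e (.loop t c) s Q :=
  ⟨_, .loop_done t c s ht, hq⟩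

theorem ends_loop_of {t : Test} {c : Cmd} (ht : t.holds e s)
    (h : Ends w e c s.tick fun s' => Ends w e (.loop t c) s' Q) : Ends w e (.loop t c) s Q := by
  obtain ⟨s₁, h₁, s₂, h₂, hq⟩ := h
  exact ⟨s₂, .loop_step _ _ _ _ _ ht h₁ h₂, hq⟩

end rules

/-- Sequential composition. -/
infixr:60 " ;; " => Cmd.seq

/-! ### Sorted insertion into a memory block -/

/-- The cells from `p` on hold the list. -/
def Seg (mem : ℕ → ℕ) : ℕ → List ℕ → Prop
  | _, [] => True
  | p, u :: l => mem p = u ∧ Seg mem (p + 1) l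

theorem Seg.congr {mem mem' : ℕ → ℕ} {p : ℕ} {l : List ℕ} (h : Seg mem p l)
    (heq : ∀ a, p ≤ a → a < p + l.length → mem' a = mem a) : Seg mem' p l := by
  induction l generalizing p with
  | nil => trivial
  | cons u l ih =>
    simp only [List.length_cons] at heq
    exact ⟨(heq p le_rfl (by omega)).trans h.1,
      ih h.2 fun a h₁ h₂ => heq a (by omega) (by omega)⟩

theorem Seg.get {mem : ℕ → ℕ} {p : ℕ} {l : List ℕ} (h : Seg mem p l) {i : ℕ}
    (hi : i < l.length) : mem (p + i) = l[i] := by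
  induction l generalizing p i with
  | nil => simp at hi
  | cons u l ih =>
    cases i with
    | zero => exact h.1
    | succ i =>
      have := ih h.2 (i := i) (by simpa using hi)
      rw [List.getElem_cons_succ, ← this]
      congr 1
      omega

open Classical in
/-- Insertion of `v` into a list of items that is sorted by the values `f`, in one pass that carries
the larger of two items on. -/
noncomputable def carry (f : ℕ → ℝ) : List ℕ → ℕ → List ℕ
  | [], v => [v]
  | u :: l, v => if f u ≤ f v then u :: carry f l v else v :: carry f l u

theorem carry_perm (f : ℕ → ℝ) (l : List ℕ) (v : ℕ) : (carry f l v).Perm (v :: l) := by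
  induction l generalizing v with
  | nil => simp [carry]
  | cons u l ih =>
    unfold carry
    split_ifs
    · exact ((ih v).cons u).trans (List.Perm.swap _ _ _)
    · exact (ih u).cons v

theorem length_carry (f : ℕ → ℝ) (l : List ℕ) (v : ℕ) : (carry f l v).length = l.length + 1 := by
  simpa using (carry_perm f l v).length_eq

theorem carry_sorted (f : ℕ → ℝ) {l : List ℕ} (v : ℕ) (h : l.Pairwise fun i j => f i ≤ f j) :
    (carry f l v).Pairwise fun i j => f i ≤ f j := by
  induction l generalizing v with
  | nil => simp [carry]
  | cons u l ih =>
    rw [List.pairwise_cons] at h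
    unfold carry
    split_ifs with huv
    · refine List.pairwise_cons.2 ⟨fun a ha => ?_, ih v h.2⟩
      rcases List.mem_cons.1 ((carry_perm f l v).mem_iff.1 ha) with rfl | ha
      · exact huv
      · exact h.1 a ha
    · refine List.pairwise_cons.2 ⟨fun a ha => ?_, ih u h.2⟩
      rcases List.mem_cons.1 ((carry_perm f l u).mem_iff.1 ha) with rfl | ha
      · exact (not_le.1 huv).le
      · exact (not_le.1 huv).le.trans (h.1 a ha)

/-- Inserts the item in register `13` into the sorted block of length `reg 8` at `reg 7`, and writes
the result to the block at `reg 10`.  Registers `2` and `17` hold the constants `1` and `0`. -/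
def carryCmd : Cmd :=
  .loop (.le 2 8)
    (.load 12 7 ;;
      .cond (.realLe (.item 12) (.item 13)) (.store 10 12) (.store 10 13 ;; .add 13 12 17) ;;
      .add 7 7 2 ;; .add 10 10 2 ;; .sub 8 8 2) ;;
  .store 10 13

/-- The destination may be the source itself, or it lies behind the source: in both cases no cell of
the source is overwritten before it has been read. -/
theorem ends_carryCmd {w : ℕ} {e : Env} {M : ℕ} (hM : M < 2 ^ w) (l : List ℕ) (s : State)
    (h2 : s.reg 2 = 1) (h17 : s.reg 17 = 0) (h8 : s.reg 8 = l.length)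
    (hseg : Seg s.mem (s.reg 7) l) (hsrc : s.reg 7 + l.length ≤ M)
    (hdst : s.reg 10 + l.length < M) (hv : s.reg 13 < M) (hl : ∀ u ∈ l, u < M)
    (hdisj : s.reg 10 = s.reg 7 ∨ s.reg 7 + l.length ≤ s.reg 10) (hc : s.cells ≤ M) :
    Ends w e carryCmd s fun s' =>
      Seg s'.mem (s.reg 10) (carry e.item l (s.reg 13)) ∧
      (∀ a, a < s.reg 10 ∨ s.reg 10 + l.length < a → s'.mem a = s.mem a) ∧
      (∀ r, r ≠ 7 → r ≠ 8 → r ≠ 10 → r ≠ 12 → r ≠ 13 → s'.reg r = s.reg r) ∧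
      s'.time ≤ s.time + 8 * l.length + 2 ∧ s'.cells ≤ M := by
  induction l generalizing s with
  | nil =>
    refine ends_seq.2 (ends_loop_of_not (by simp [Test.holds, h2, h8]) ?_)
    simp only [List.length_nil] at *
    simp [ends_store, carry, Seg, State.tick, State.touch]
    refine ⟨fun a ha => Function.update_of_ne (by omega) _ _, hc, by omega⟩
  | cons u l ih =>
    simp only [List.length_cons, List.forall_mem_cons] at *
    obtain ⟨hu, hseg⟩ := hseg
    -- One round leads to a state `s₁` to which the induction hypothesis applies.
    have key : ∀ s₁ : State, s₁.reg 2 = 1 → s₁.reg 17 = 0 → s₁.reg 8 = l.length →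
        s₁.reg 7 = s.reg 7 + 1 → s₁.reg 10 = s.reg 10 + 1 → s₁.reg 13 < M →
        (∀ a, a ≠ s.reg 10 → s₁.mem a = s.mem a) →
        carry e.item (u :: l) (s.reg 13) = s₁.mem (s.reg 10) :: carry e.item l (s₁.reg 13) →
        (∀ r, r ≠ 7 → r ≠ 8 → r ≠ 10 → r ≠ 12 → r ≠ 13 → s₁.reg r = s.reg r) →
        s₁.time ≤ s.time + 8 → s₁.cells ≤ M →
        Ends w e carryCmd s₁ fun s' =>
          Seg s'.mem (s.reg 10) (carry e.item (u :: l) (s.reg 13)) ∧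
          (∀ a, a < s.reg 10 ∨ s.reg 10 + (l.length + 1) < a → s'.mem a = s.mem a) ∧
          (∀ r, r ≠ 7 → r ≠ 8 → r ≠ 10 → r ≠ 12 → r ≠ 13 → s'.reg r = s.reg r) ∧
          s'.time ≤ s.time + 8 * (l.length + 1) + 2 ∧ s'.cells ≤ M := by
      intro s₁ k2 k17 k8 k7 k10 k13 kmem kcarry kreg ktime kcells
      refine (ih s₁ k2 k17 k8 ?_ (by omega) (by omega) k13 hl.2 (by omega) kcells).mono ?_
      · rw [k7]
        exact hseg.congr fun a h₁ h₂ => kmem a (by omega)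
      · rintro s' ⟨q1, q2, q3, q4, q5⟩
        refine ⟨?_, fun a ha => ?_, fun r r1 r2 r3 r4 r5 => ?_, by omega, q5⟩
        · rw [kcarry]
          exact ⟨q2 _ (by omega), by rwa [k10] at q1⟩
        · rw [q2 a (by omega), kmem a (by omega)]
        · rw [q3 r r1 r2 r3 r4 r5, kreg r r1 r2 r3 r4 r5]
    simp only [carryCmd, ends_seq (c₂ := .store 10 13)] at key ⊢
    generalize (fun s' => Ends w e (.store 10 13) s' _) = P at key ⊢
    refine ends_loop_of (by simp [Test.holds, h2, h8]) ?_
    simp [ends_seq, ends_cond, ends_load, ends_store, ends_add, ends_sub, State.tick, State.touch,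
      State.set, Test.holds, RealOp.val, h2, h17, h8, hu]
    refine ⟨fun hle => ⟨by omega, by omega, by omega, ?_⟩,
      fun hle => ⟨by omega, by omega, by omega, by omega, ?_⟩⟩
    all_goals
      apply key <;> simp [h2, h17, hv, carry]
    · intro a ha
      exact Function.update_of_ne ha _ _
    · exact fun h => absurd hle (not_le.2 h)
    · intro r r1 r2 r3 r4 r5
      simp [*]
    · omega
    · omega
    · intro a ha
      exact Function.update_of_ne ha _ _
    · simp [hle]
    · intro r r1 r2 r3 r4 r5
      simp [*]
    · omega

/-! ### The bucket structure in memory -/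

/-- The memory holds the item lists `ℓ 0, …, ℓ m` of `m + 1` buckets, `i` items in total.  Cell `0`
holds `m`, cell `1` the first unused cell, and the record of bucket `b` consists of the cells
`4 * b + 4, …, 4 * b + 7`: address of its block, number of items, capacity of its block, and next
nonempty bucket (which is not part of this predicate).  Blocks lie above the records.

A full block of length `L` is abandoned for a new one of capacity `2 * L + 1`.  The field `alloc`
bounds all cells ever allotted, those of abandoned blocks included, by twice the capacity of the
blocks in use. -/
structure Rep (mem : ℕ → ℕ) (m i : ℕ) (ℓ : ℕ → List ℕ) : Prop where
  num : mem 0 = m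
  len : ∀ b ≤ m, mem (4 * b + 5) = (ℓ b).length
  seg : ∀ b ≤ m, Seg mem (mem (4 * b + 4)) (ℓ b)
  len_le : ∀ b ≤ m, (ℓ b).length ≤ mem (4 * b + 6)
  cap_le : ∀ b ≤ m, mem (4 * b + 6) ≤ 2 * (ℓ b).length
  base : ∀ b ≤ m, 4 * m + 8 ≤ mem (4 * b + 4)
  top : ∀ b ≤ m, mem (4 * b + 4) + mem (4 * b + 6) ≤ mem 1
  disj : ∀ b ≤ m, ∀ b' ≤ m, b ≠ b' → mem (4 * b + 4) + mem (4 * b + 6) ≤ mem (4 * b' + 4) ∨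
    mem (4 * b' + 4) + mem (4 * b' + 6) ≤ mem (4 * b + 4)
  alloc : mem 1 ≤ 4 * m + 8 + ∑ b ∈ Finset.range (m + 1), 2 * mem (4 * b + 6)
  total : ∑ b ∈ Finset.range (m + 1), (ℓ b).length = i
  lt : ∀ b ≤ m, ∀ u ∈ ℓ b, u < i

namespace Rep

variable {mem mem' : ℕ → ℕ} {m i : ℕ} {ℓ : ℕ → List ℕ}

/-- The structure takes linear space. -/
theorem top_le (h : Rep mem m i ℓ) : mem 1 ≤ 4 * m + 8 + 4 * i := by
  refine h.alloc.trans (Nat.add_le_add_left ?_ _)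
  rw [← h.total, Finset.mul_sum]
  refine Finset.sum_le_sum fun b hb => ?_
  have := h.cap_le b (by simpa [Nat.lt_succ_iff] using hb)
  omega

/-- A bucket whose block is full accounts for less than its share of the bound `top_le`. -/
theorem top_add_le (h : Rep mem m i ℓ) {B : ℕ} (hB : B ≤ m) :
    mem 1 + 4 * (ℓ B).length ≤ 4 * m + 8 + 4 * i + 2 * mem (4 * B + 6) := by
  have hmem : B ∈ Finset.range (m + 1) := by simp; omega
  have q := h.alloc
  have q' := h.total
  rw [← Finset.add_sum_erase _ _ hmem] at q q'
  have : ∑ b ∈ (Finset.range (m + 1)).erase B, 2 * mem (4 * b + 6) ≤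
      4 * ∑ b ∈ (Finset.range (m + 1)).erase B, (ℓ b).length := by
    rw [Finset.mul_sum]
    refine Finset.sum_le_sum fun b hb => ?_
    have := h.cap_le b (by
      have := Finset.mem_range.1 (Finset.mem_of_mem_erase hb)
      omega)
    omega
  omega

/-- The link fields are not part of the structure. -/
theorem congr (h : Rep mem m i ℓ)
    (heq : ∀ a, (∀ b ≤ m, a ≠ 4 * b + 7) → mem' a = mem a) : Rep mem' m i ℓ := by
  have h0 : mem' 0 = mem 0 := heq _ (by omega)
  have h1 : mem' 1 = mem 1 := heq _ (by omega)
  have h4 : ∀ b, mem' (4 * b + 4) = mem (4 * b + 4) := fun b => heq _ (by omega)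
  have h5 : ∀ b, mem' (4 * b + 5) = mem (4 * b + 5) := fun b => heq _ (by omega)
  have h6 : ∀ b, mem' (4 * b + 6) = mem (4 * b + 6) := fun b => heq _ (by omega)
  constructor <;> try simp only [h0, h1, h4, h5, h6]
  · exact h.num
  · exact h.len
  · refine fun b hb => (h.seg b hb).congr fun a ha _ => heq _ fun b' hb' => ?_
    have := h.base b hb
    omega
  · exact h.len_le
  · exact h.cap_le
  · exact h.base
  · exact h.top
  · exact h.disj
  · exact h.alloc
  · exact h.total
  · exact h.lt

/-- The effect of an insertion into bucket `B`: its block is kept, or it is replaced by a new block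
above all others, of at most twice the capacity that is needed. -/
theorem insert (h : Rep mem m i ℓ) {B p cap : ℕ} (hB : B ≤ m) {l : List ℕ}
    (hl : l.length = (ℓ B).length + 1) (hlt : ∀ u ∈ l, u < i + 1) (hseg : Seg mem' p l)
    (hp : mem' (4 * B + 4) = p) (hlen : mem' (4 * B + 5) = l.length)
    (hcap : mem' (4 * B + 6) = cap) (hcap1 : l.length ≤ cap) (hcap2 : cap ≤ 2 * l.length)
    (htop : mem' 1 + 2 * mem (4 * B + 6) ≤ mem 1 + 2 * cap) (hmono : mem 1 ≤ mem' 1)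
    (hbase : 4 * m + 8 ≤ p) (hblock : p + cap ≤ mem' 1)
    (hnew : p = mem (4 * B + 4) ∧ cap = mem (4 * B + 6) ∨ mem 1 ≤ p)
    (heq : ∀ a, a ≠ 1 → a ≠ 4 * B + 4 → a ≠ 4 * B + 5 → a ≠ 4 * B + 6 →
      (a < p ∨ p + l.length ≤ a) → mem' a = mem a) :
    Rep mem' m (i + 1) (Function.update ℓ B l) := by
  have g : ∀ b ≤ m, b ≠ B → mem' (4 * b + 4) = mem (4 * b + 4) ∧
      mem' (4 * b + 5) = mem (4 * b + 5) ∧ mem' (4 * b + 6) = mem (4 * b + 6) := fun b hb hbB =>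
    ⟨heq _ (by omega) (by omega) (by omega) (by omega) (by omega),
     heq _ (by omega) (by omega) (by omega) (by omega) (by omega),
     heq _ (by omega) (by omega) (by omega) (by omega) (by omega)⟩
  have hmem : B ∈ Finset.range (m + 1) := by simp; omega
  constructor
  · rw [heq 0 (by omega) (by omega) (by omega) (by omega) (by omega), h.num]
  · intro b hb
    rcases eq_or_ne b B with rfl | hbB
    · simpa using hlen
    · rw [Function.update_of_ne hbB, (g b hb hbB).2.1, h.len b hb]
  · intro b hb
    rcases eq_or_ne b B with rfl | hbB
    · simpa [hp] using hseg
    · rw [Function.update_of_ne hbB, (g b hb hbB).1]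
      refine (h.seg b hb).congr fun a h1 h2 => ?_
      have q1 := h.base b hb
      have q2 := h.top b hb
      have q3 := h.len_le b hb
      have q4 := h.disj b hb B hB hbB
      refine heq _ (by omega) (by omega) (by omega) (by omega) (by omega)
  · intro b hb
    rcases eq_or_ne b B with rfl | hbB
    · simpa [hcap] using hcap1
    · rw [Function.update_of_ne hbB, (g b hb hbB).2.2]
      exact h.len_le b hb
  · intro b hb
    rcases eq_or_ne b B with rfl | hbB
    · simpa [hcap] using hcap2
    · rw [Function.update_of_ne hbB, (g b hb hbB).2.2]
      exact h.cap_le b hb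
  · intro b hb
    rcases eq_or_ne b B with rfl | hbB
    · omega
    · rw [(g b hb hbB).1]
      exact h.base b hb
  · intro b hb
    rcases eq_or_ne b B with rfl | hbB
    · omega
    · rw [(g b hb hbB).1, (g b hb hbB).2.2]
      exact (h.top b hb).trans hmono
  · intro b hb b' hb' hbb'
    have q1 := h.disj b hb b' hb' hbb'
    have q2 := h.top b hb
    have q3 := h.top b' hb'
    rcases eq_or_ne b B with rfl | hbB
    · have := g b' hb' hbb'.symm
      omega
    · have := g b hb hbB
      rcases eq_or_ne b' B with rfl | hbB'
      · omega
      · have := g b' hb' hbB'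
        omega
  · have q := h.alloc
    have q' : ∑ b ∈ (Finset.range (m + 1)).erase B, 2 * mem' (4 * b + 6) =
        ∑ b ∈ (Finset.range (m + 1)).erase B, 2 * mem (4 * b + 6) := by
      refine Finset.sum_congr rfl fun b hb => ?_
      rw [Finset.mem_erase, Finset.mem_range] at hb
      rw [(g b (by omega) hb.1).2.2]
    rw [← Finset.add_sum_erase _ _ hmem] at q ⊢
    rw [q', hcap]
    omega
  · have q := h.total
    have q' : ∑ b ∈ (Finset.range (m + 1)).erase B, (Function.update ℓ B l b).length =
        ∑ b ∈ (Finset.range (m + 1)).erase B, (ℓ b).length := by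
      refine Finset.sum_congr rfl fun b hb => ?_
      rw [Function.update_of_ne (Finset.ne_of_mem_erase hb)]
    rw [← Finset.add_sum_erase _ _ hmem] at q ⊢
    rw [q', Function.update_self]
    omega
  · intro b hb
    rcases eq_or_ne b B with rfl | hbB
    · simpa using hlt
    · rw [Function.update_of_ne hbB]
      exact fun u hu => (h.lt b hb u hu).trans (Nat.lt_succ_self i)

end Rep

/-- The bucket of the real number `t`, when `[0, 1]` is cut into `m` intervals of equal length; the
point `1` has a bucket of its own. -/
noncomputable def bucket (m : ℕ) (t : ℝ) : ℕ := ⌊(m : ℝ) * t⌋₊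

theorem bucket_le (m : ℕ) {t : ℝ} (ht : t ∈ Icc (0 : ℝ) 1) : bucket m t ≤ m :=
  Nat.floor_le_of_le (mul_le_of_le_one_right (Nat.cast_nonneg m) ht.2)

theorem bucket_mono (m : ℕ) {t u : ℝ} (h : t ≤ u) : bucket m t ≤ bucket m u :=
  Nat.floor_le_floor (mul_le_mul_of_nonneg_left h (Nat.cast_nonneg m))

/-- Registers `0` to `3` and `17`: number of items, number of intervals, and constants.  The other
registers are used as follows: `4` item, `5` bucket, `6` address of its record, `7` address of its
block, `8` number of its items, `9` capacity or a constant, `10` address of a new block, `11` to `14`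
work space, `15` and `16` loop variables. -/
structure Std (s : State) (K m : ℕ) : Prop where
  r0 : s.reg 0 = K
  r1 : s.reg 1 = m
  r2 : s.reg 2 = 1
  r3 : s.reg 3 = 4
  r17 : s.reg 17 = 0

theorem Std.congr {s s' : State} {K m : ℕ} (h : Std s K m)
    (heq : ∀ r, r < 4 ∨ r = 17 → s'.reg r = s.reg r) : Std s' K m := by
  constructor
  · rw [heq _ (by omega), h.r0]
  · rw [heq _ (by omega), h.r1]
  · rw [heq _ (by omega), h.r2]
  · rw [heq _ (by omega), h.r3]
  · rw [heq _ (by omega), h.r17]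

/-- Inserts the item in register `4` into its bucket, whose number is left in register `5`. -/
def insertItem : Cmd :=
  .piece 5 (.item 4) .zero .one 1 ;;
  .mul 6 5 3 ;; .add 6 6 3 ;; .load 7 6 ;;
  .add 14 6 2 ;; .load 8 14 ;; .add 14 14 2 ;; .load 9 14 ;;
  .cond (.le 9 8)
    (.load 10 2 ;; .add 9 8 8 ;; .add 9 9 2 ;; .store 14 9 ;;
      .add 14 10 9 ;; .store 2 14 ;; .store 6 10)
    (.add 10 7 17) ;;
  .add 14 8 2 ;; .add 11 6 2 ;; .store 11 14 ;; .add 13 4 17 ;;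
  carryCmd

theorem ends_insertItem {w : ℕ} {e : Env} {n : ℕ} (hw : 64 * (n + 1) ≤ 2 ^ w) {s : State}
    {K m i : ℕ} {ℓ : ℕ → List ℕ} (hs : Std s K m) (hi : s.reg 4 = i) (hrep : Rep s.mem m i ℓ)
    (hm : m ≤ n) (hin : i < n) (hx : e.item i ∈ Icc (0 : ℝ) 1) (hc : s.cells ≤ 8 * n + 16) :
    Ends w e insertItem s fun s' =>
      Rep s'.mem m (i + 1)
        (Function.update ℓ (bucket m (e.item i)) (carry e.item (ℓ (bucket m (e.item i))) i)) ∧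
      (∀ b ≤ m, s'.mem (4 * b + 7) = s.mem (4 * b + 7)) ∧
      s'.reg 5 = bucket m (e.item i) ∧
      (∀ r, r ≤ 4 ∨ 15 ≤ r → s'.reg r = s.reg r) ∧
      s'.time ≤ s.time + (8 * (ℓ (bucket m (e.item i))).length + 30) ∧ s'.cells ≤ 8 * n + 16 := by
  obtain ⟨h0, h1, h2, h3, h17⟩ := hs
  have hB := bucket_le m hx
  generalize hBd : bucket m (e.item i) = B at hB ⊢
  have hfl : ⌊(m : ℝ) * e.item i⌋₊ = B := hBd
  have q0 := hrep.num
  have q1 := hrep.len B hB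
  have q2 := hrep.len_le B hB
  have q3 := hrep.cap_le B hB
  have q4 := hrep.base B hB
  have q5 := hrep.top B hB
  have q6 := hrep.top_le
  have q8 := hrep.top_add_le hB
  have q7 : (ℓ B).length ≤ i := by
    rw [← hrep.total]
    exact Finset.single_le_sum (f := fun b => (ℓ b).length) (fun _ _ => Nat.zero_le _)
      (Finset.mem_range.2 (Nat.lt_succ_of_le hB))
  generalize hP : (fun s' : State => _) = P
  -- The state in which the block is written: `p` is its address, `cap` its capacity, and `top` the
  -- first unused cell.
  have key : ∀ (s₁ : State) (p cap top : ℕ), s₁.reg 2 = 1 → s₁.reg 17 = 0 → s₁.reg 5 = B →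
      s₁.reg 7 = s.mem (4 * B + 4) → s₁.reg 8 = (ℓ B).length → s₁.reg 10 = p → s₁.reg 13 = i →
      s₁.mem 1 = top → s₁.mem (4 * B + 4) = p → s₁.mem (4 * B + 5) = (ℓ B).length + 1 →
      s₁.mem (4 * B + 6) = cap →
      (∀ a, a ≠ 1 → a ≠ 4 * B + 4 → a ≠ 4 * B + 5 → a ≠ 4 * B + 6 → s₁.mem a = s.mem a) →
      (p = s.mem (4 * B + 4) ∧ cap = s.mem (4 * B + 6) ∧ (ℓ B).length < cap ∧ top = s.mem 1 ∨
        p = s.mem 1 ∧ cap = 2 * (ℓ B).length + 1 ∧ s.mem (4 * B + 6) ≤ (ℓ B).length ∧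
          top = s.mem 1 + cap) →
      (∀ r, r ≤ 4 ∨ 15 ≤ r → s₁.reg r = s.reg r) →
      s₁.time ≤ s.time + 28 → s₁.cells ≤ 8 * n + 16 → Ends w e carryCmd s₁ P := by
    intro s₁ p cap top k2 k17 k5 k7 k8 k10 k13 kt kp kl kc kmem kcase kreg ktime kcells
    refine (ends_carryCmd (M := 8 * n + 16) (by omega) (ℓ B) s₁ k2 k17 k8 ?_ (by omega) (by omega)
      (by omega) (fun u hu => ?_) (by omega) kcells).mono ?_
    · rw [k7]
      exact (hrep.seg B hB).congr fun a _ _ =>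
        kmem a (by omega) (by omega) (by omega) (by omega)
    · have := hrep.lt B hB u hu
      omega
    · rintro s' ⟨r1, r2, r3, r4, r5⟩
      rw [k10, k13] at r1
      rw [← hP]
      have hlc := length_carry e.item (ℓ B) i
      have r1' := r2 1 (by omega)
      refine ⟨hrep.insert (p := p) (cap := cap) hB hlc ?_ r1 ?_ ?_ ?_ (by omega) (by omega)
        (by omega) (by omega) (by omega) (by omega) (by omega) ?_, fun b hb => ?_, ?_, fun r hr => ?_,
        by omega, r5⟩
      · intro u hu
        rcases List.mem_cons.1 ((carry_perm _ _ _).mem_iff.1 hu) with rfl | hu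
        · omega
        · have := hrep.lt B hB u hu
          omega
      · rw [r2 _ (by omega), kp]
      · rw [r2 _ (by omega), kl, hlc]
      · rw [r2 _ (by omega), kc]
      · intro a a1 a2 a3 a4 a5
        rw [r2 a (by omega), kmem a a1 a2 a3 a4]
      · rw [r2 _ (by omega), kmem _ (by omega) (by omega) (by omega) (by omega)]
      · rw [r3 _ (by omega) (by omega) (by omega) (by omega) (by omega), k5]
      · rw [r3 _ (by omega) (by omega) (by omega) (by omega) (by omega), kreg r hr]
  have e4 : B * 4 + 4 = 4 * B + 4 := by ring
  have e5 : 4 * B + 4 + 1 = 4 * B + 5 := rfl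
  have e6 : 4 * B + 5 + 1 = 4 * B + 6 := rfl
  simp only [insertItem, ends_seq (c₂ := _ ;; _), ends_seq (c₁ := .add 13 4 17)]
  generalize carryCmd = cmd at key ⊢
  simp [ends_cond, ends_load, ends_store, ends_add, ends_mul, ends_piece, ends_seq,
    State.tick, State.touch, State.set, Test.holds, RealOp.val, h1, h2, h3, h17, hi, hfl, e4, e5, e6,
    q1]
  refine ⟨by omega, by omega, by omega, by omega, by omega,
    fun hfull => ⟨by omega, by omega, by omega, by omega, by omega, by omega, ?_⟩,
    fun hfull => ⟨by omega, by omega, by omega, by omega, ?_⟩⟩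
  · refine key _ (s.mem 1) (2 * (ℓ B).length + 1) (s.mem 1 + (2 * (ℓ B).length + 1))
      ?_ ?_ ?_ ?_ ?_ ?_ ?_ ?_ ?_ ?_ ?_ (fun a a1 a2 a3 a4 => ?_) ?_ (fun r hr => ?_) ?_ ?_ <;>
      simp <;> try omega
    · simp [a1, a2, a3, a4]
    · have : ∀ j, 5 ≤ j → j ≤ 14 → r ≠ j := by omega
      simp [this]
  · refine key _ (s.mem (4 * B + 4)) (s.mem (4 * B + 6)) (s.mem 1)
      ?_ ?_ ?_ ?_ ?_ ?_ ?_ ?_ ?_ ?_ ?_ (fun a a1 a2 a3 a4 => ?_) ?_ (fun r hr => ?_) ?_ ?_ <;>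
      simp <;> try omega
    · simp [a3]
    · have : ∀ j, 5 ≤ j → j ≤ 14 → r ≠ j := by omega
      simp [this]

/-- The number of items among the first `i` that lie in bucket `b`. -/
noncomputable def load (X : ℕ → ℝ) (m i b : ℕ) : ℕ := by
  classical exact ((Finset.range i).filter fun j => bucket m (X j) = b).card

/-- The lists `ℓ b` are the first `i` items, distributed among the buckets and sorted. -/
structure Good (X : ℕ → ℝ) (m i : ℕ) (ℓ : ℕ → List ℕ) : Prop where
  sorted : ∀ b, (ℓ b).Pairwise fun j j' => X j ≤ X j'
  nodup : ∀ b, (ℓ b).Nodup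
  mem_iff : ∀ b j, j ∈ ℓ b ↔ j < i ∧ bucket m (X j) = b

namespace Good

variable {X Y : ℕ → ℝ} {m i : ℕ} {ℓ : ℕ → List ℕ}

theorem nil (X : ℕ → ℝ) (m : ℕ) : Good X m 0 fun _ => [] := by
  constructor <;> simp

theorem congr (h : Good X m i ℓ) (hXY : ∀ j < i, X j = Y j) : Good Y m i ℓ where
  sorted b := (h.sorted b).imp_of_mem fun {j j'} hj hj' hle => by
    rwa [← hXY j ((h.mem_iff b j).1 hj).1, ← hXY j' ((h.mem_iff b j').1 hj').1]
  nodup := h.nodup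
  mem_iff b j := by
    rw [h.mem_iff]
    exact and_congr_right fun hj => by rw [hXY j hj]

theorem insert (h : Good X m i ℓ) :
    Good X m (i + 1) (Function.update ℓ (bucket m (X i)) (carry X (ℓ (bucket m (X i))) i)) := by
  constructor
  · intro b
    rcases eq_or_ne b (bucket m (X i)) with rfl | hb
    · simpa using carry_sorted X i (h.sorted _)
    · rw [Function.update_of_ne hb]
      exact h.sorted b
  · intro b
    rcases eq_or_ne b (bucket m (X i)) with rfl | hb
    · rw [Function.update_self, (carry_perm _ _ _).nodup_iff, List.nodup_cons, h.mem_iff]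
      exact ⟨by simp, h.nodup _⟩
    · rw [Function.update_of_ne hb]
      exact h.nodup b
  · intro b j
    rcases eq_or_ne b (bucket m (X i)) with rfl | hb
    · rw [Function.update_self, (carry_perm _ _ _).mem_iff, List.mem_cons, h.mem_iff,
        Nat.lt_succ_iff_lt_or_eq]
      constructor
      · rintro (rfl | h)
        · exact ⟨.inr rfl, rfl⟩
        · exact ⟨.inl h.1, h.2⟩
      · rintro ⟨h | rfl, h'⟩
        · exact .inr ⟨h, h'⟩
        · exact .inl rfl
    · rw [Function.update_of_ne hb, h.mem_iff, Nat.lt_succ_iff_lt_or_eq]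
      constructor
      · exact fun h => ⟨.inl h.1, h.2⟩
      · rintro ⟨h | rfl, h'⟩
        · exact ⟨h, h'⟩
        · exact absurd h'.symm hb

theorem length_eq (h : Good X m i ℓ) (b : ℕ) : (ℓ b).length = load X m i b := by
  classical
  rw [← List.toFinset_card_of_nodup (h.nodup b), load]
  congr 1
  ext j
  simp [h.mem_iff]

end Good

/-! ### Links between nonempty buckets -/

/-- `c` is the first nonempty bucket after `b`, or `m + 1` if there is none. -/
def IsNext (ℓ : ℕ → List ℕ) (m b c : ℕ) : Prop :=
  b < c ∧ c ≤ m + 1 ∧ (∀ b', b < b' → b' < c → ℓ b' = []) ∧ (c ≤ m → ℓ c ≠ [])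

/-- The number of zeros of `L` immediately before `t`. -/
def zeroRun (L : ℕ → ℕ) : ℕ → ℕ
  | 0 => 0
  | t + 1 => if L t = 0 then zeroRun L t + 1 else 0

theorem zeroRun_congr {L L' : ℕ → ℕ} {t : ℕ} (h : ∀ b < t, L b = L' b) :
    zeroRun L t = zeroRun L' t := by
  induction t with
  | zero => rfl
  | succ t ih =>
    rw [zeroRun, zeroRun, h t t.lt_succ_self, ih fun b hb => h b (hb.trans t.lt_succ_self)]

/-- Writes register `5` into the link fields of the buckets before it, down to a nonempty one. -/
def relink : Cmd :=
  .add 15 5 17 ;;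
  .loop (.le 2 15)
    (.sub 15 15 2 ;; .mul 14 15 3 ;; .add 14 14 3 ;; .add 14 14 2 ;; .load 8 14 ;;
      .add 14 14 2 ;; .add 14 14 2 ;; .store 14 5 ;; .cond (.le 2 8) (.const 15 0) .skip)

/-- The loop stops at bucket `z`, which is nonempty or `0`. -/
theorem ends_relink_loop {w : ℕ} {e : Env} {n : ℕ} (hw : 64 * (n + 1) ≤ 2 ^ w) {K m B : ℕ}
    (hm : m ≤ n) (hB : B ≤ m) {L : ℕ → ℕ} (t : ℕ) (ht : t ≤ B) (s : State) (hs : Std s K m)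
    (h5 : s.reg 5 = B) (h15 : s.reg 15 = t) (hlen : ∀ b ≤ m, s.mem (4 * b + 5) = L b)
    (hc : s.cells ≤ 8 * n + 16) :
    Ends w e (.loop (.le 2 15)
      (.sub 15 15 2 ;; .mul 14 15 3 ;; .add 14 14 3 ;; .add 14 14 2 ;; .load 8 14 ;;
        .add 14 14 2 ;; .add 14 14 2 ;; .store 14 5 ;; .cond (.le 2 8) (.const 15 0) .skip)) s
      fun s' => ∃ z ≤ t, (∀ b, z ≤ b → b < t → s'.mem (4 * b + 7) = B) ∧
        (∀ b, z < b → b < t → L b = 0) ∧ (z ≠ 0 → z < t → L z ≠ 0) ∧ (z = t → t = 0) ∧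
        (∀ a, (∀ b, z ≤ b → b < t → a ≠ 4 * b + 7) → s'.mem a = s.mem a) ∧
        s'.time ≤ s.time + (12 * zeroRun L t + 13) ∧ s'.cells ≤ 8 * n + 16 := by
  induction t generalizing s with
  | zero =>
    refine ends_loop_of_not (by simp [Test.holds, hs.r2, h15]) ?_
    exact ⟨0, le_rfl, by omega, by omega, by omega, fun _ => rfl, fun _ _ => rfl,
      by simp [State.tick], hc⟩
  | succ t ih =>
    obtain ⟨h0, h1, h2, h3, h17⟩ := id hs
    refine ends_loop_of (by simp [Test.holds, h2, h15]) ?_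
    have e4 : t * 4 + 4 = 4 * t + 4 := by ring
    have e5 : 4 * t + 4 + 1 = 4 * t + 5 := rfl
    have e6 : 4 * t + 5 + 1 = 4 * t + 6 := rfl
    have e7 : 4 * t + 6 + 1 = 4 * t + 7 := rfl
    generalize hP : (fun s' : State => Ends _ _ _ s' _) = P
    simp [ends_seq, ends_cond, ends_load, ends_store, ends_add, ends_sub, ends_mul, ends_const,
      ends_skip, State.tick, State.touch, State.set, Test.holds, h2, h3, h5, h15, e4, e5, e6, e7,
      hlen t (by omega)]
    subst hP
    refine ⟨by omega, by omega, by omega, by omega, by omega, by omega, fun hL => ?_, fun hL => ?_⟩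
    · refine ends_loop_of_not (by simp [Test.holds, h2]) ?_
      refine ⟨t, by omega, fun b hb hb' => ?_, by omega, fun _ _ => by omega, by omega,
        fun a ha => ?_, ?_, ?_⟩
      · obtain rfl : b = t := by omega
        simp [State.tick]
      · have := ha t le_rfl t.lt_succ_self
        simp [State.tick, this]
      · simp [State.tick]
        omega
      · simp [State.tick]
        omega
    · refine (ih (by omega) _ (hs.congr fun r hr => ?_) ?_ ?_ ?_ ?_).mono ?_
      · have : ∀ j, (4 ≤ j ∧ j ≠ 17) → r ≠ j := by omega
        simp [this]
      · simp [h5]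
      · simp
      · intro b hb
        rw [← hlen b hb]
        exact Function.update_of_ne (by omega) _ _
      · simp
        omega
      · rintro s' ⟨z, z1, z2, z3, z4, z5, z6, z7, z8⟩
        refine ⟨z, by omega, fun b hb hb' => ?_, fun b hb hb' => ?_, fun h h' => ?_, by omega,
          fun a ha => ?_, ?_, z8⟩
        · rcases Nat.lt_succ_iff_lt_or_eq.1 hb' with hb' | rfl
          · exact z2 b hb hb'
          · rw [z6 _ (by omega)]
            simp
        · rcases Nat.lt_succ_iff_lt_or_eq.1 hb' with hb' | rfl
          · exact z3 b hb hb'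
          · exact hL
        · exact z4 h (by omega)
        · rw [z6 a fun b hb hb' => ha b hb (by omega)]
          have := ha t z1 t.lt_succ_self
          simp [this]
        · rw [zeroRun, if_pos hL]
          simp at z7
          omega

theorem ends_relink {w : ℕ} {e : Env} {n : ℕ} (hw : 64 * (n + 1) ≤ 2 ^ w) {K m B i : ℕ}
    (hm : m ≤ n) (hB : B ≤ m) {ℓ : ℕ → List ℕ} {l : List ℕ} (hl : l ≠ []) {s : State}
    (hs : Std s K m) (h5 : s.reg 5 = B) (hrep : Rep s.mem m i (Function.update ℓ B l))
    (hnext : ∀ b ≤ m, IsNext ℓ m b (s.mem (4 * b + 7))) (hc : s.cells ≤ 8 * n + 16) :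
    Ends w e relink s fun s' => Rep s'.mem m i (Function.update ℓ B l) ∧
      (∀ b ≤ m, IsNext (Function.update ℓ B l) m b (s'.mem (4 * b + 7))) ∧
      s'.time ≤ s.time + (12 * zeroRun (fun b => (ℓ b).length) B + 14) ∧
      s'.cells ≤ 8 * n + 16 := by
  rw [relink, ends_seq, ends_add]
  refine ⟨by rw [h5, hs.r17]; omega, ?_⟩
  refine (ends_relink_loop hw hm hB B le_rfl _ (hs.congr fun r hr => ?_) ?_ ?_ (by exact hrep.len) ?_).mono ?_
  · have : r ≠ 15 := by omega
    simp [State.tick, State.set, this]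
  · simp [State.tick, State.set, h5]
  · simp [State.tick, State.set, h5, hs.r17]
  · simpa [State.tick, State.set] using hc
  rintro s' ⟨z, z1, z2, z3, z4, z5, z6, z7, z8⟩
  simp only [State.tick, State.set] at z6 z7
  rw [zeroRun_congr (L' := fun b => (ℓ b).length) fun b hb => by
    rw [Function.update_of_ne hb.ne]] at z7
  refine ⟨hrep.congr fun a ha => z6 a fun b _ hb => ha b (by omega), fun b hb => ?_, by omega, z8⟩
  by_cases hzb : z ≤ b ∧ b < B
  · rw [z2 b hzb.1 hzb.2]
    refine ⟨hzb.2, by omega, fun b' h1 h2 => ?_, fun _ => by simpa using hl⟩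
    simpa using z3 b' (by omega) h2
  · rw [z6 _ (by omega)]
    obtain ⟨q1, q2, q3, q4⟩ := hnext b hb
    -- The link of a bucket before `z` does not jump over `z`, which is nonempty.
    have hjump : b < B → s.mem (4 * b + 7) < B := by
      intro hbB
      have hz0 : z ≠ 0 := by omega
      have hzB : z < B := lt_of_le_of_ne z1 fun h => hz0 (h.trans (z5 h))
      by_contra hcon
      have := z4 hz0 hzB
      rw [Function.update_of_ne hzB.ne] at this
      exact this (by rw [q3 z (by omega) (by omega)]; rfl)
    have hne : ∀ b', b < b' → b' < s.mem (4 * b + 7) → b' ≠ B := by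
      intro b' h1 h2
      by_cases hbB : b < B
      · have := hjump hbB
        omega
      · omega
    refine ⟨q1, q2, fun b' h1 h2 => ?_, fun h => ?_⟩
    · rw [Function.update_of_ne (hne b' h1 h2)]
      exact q3 b' h1 h2
    · have : s.mem (4 * b + 7) ≠ B := by
        by_cases hbB : b < B
        · exact (hjump hbB).ne
        · omega
      rw [Function.update_of_ne this]
      exact q4 h

/-- Computes all link fields, from the last bucket to the first. -/
def link : Cmd :=
  .add 16 1 2 ;; .add 15 1 2 ;;
  .loop (.le 2 15)
    (.sub 15 15 2 ;; .mul 14 15 3 ;; .add 14 14 3 ;; .add 14 14 2 ;; .load 8 14 ;;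
      .add 14 14 2 ;; .add 14 14 2 ;; .store 14 16 ;; .cond (.le 2 8) (.add 16 15 17) .skip)

/-- Here `c` is the first nonempty bucket from `t` on, or `m + 1`. -/
theorem ends_link_loop {w : ℕ} {e : Env} {n : ℕ} (hw : 64 * (n + 1) ≤ 2 ^ w) {K m : ℕ}
    (hm : m ≤ n) {ℓ : ℕ → List ℕ} (t c : ℕ) (ht : t ≤ m + 1) (htc : t ≤ c) (hcm : c ≤ m + 1)
    (hempty : ∀ b, t ≤ b → b < c → ℓ b = []) (hfull : c ≤ m → ℓ c ≠ []) (s : State)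
    (hs : Std s K m) (h15 : s.reg 15 = t) (h16 : s.reg 16 = c)
    (hlen : ∀ b ≤ m, s.mem (4 * b + 5) = (ℓ b).length) (hc : s.cells ≤ 8 * n + 16) :
    Ends w e (.loop (.le 2 15)
      (.sub 15 15 2 ;; .mul 14 15 3 ;; .add 14 14 3 ;; .add 14 14 2 ;; .load 8 14 ;;
        .add 14 14 2 ;; .add 14 14 2 ;; .store 14 16 ;; .cond (.le 2 8) (.add 16 15 17) .skip)) s
      fun s' => (∀ b < t, IsNext ℓ m b (s'.mem (4 * b + 7))) ∧
        (∀ a, (∀ b < t, a ≠ 4 * b + 7) → s'.mem a = s.mem a) ∧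
        s'.time ≤ s.time + (11 * t + 1) ∧ s'.cells ≤ 8 * n + 16 := by
  induction t generalizing s c with
  | zero =>
    refine ends_loop_of_not (by simp [Test.holds, hs.r2, h15]) ?_
    exact ⟨by omega, fun _ _ => rfl, by simp [State.tick], hc⟩
  | succ t ih =>
    obtain ⟨h0, h1, h2, h3, h17⟩ := id hs
    refine ends_loop_of (by simp [Test.holds, h2, h15]) ?_
    have e4 : t * 4 + 4 = 4 * t + 4 := by ring
    have e5 : 4 * t + 4 + 1 = 4 * t + 5 := rfl
    have e6 : 4 * t + 5 + 1 = 4 * t + 6 := rfl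
    have e7 : 4 * t + 6 + 1 = 4 * t + 7 := rfl
    have key : ∀ (s₁ : State) (c' : ℕ), t ≤ c' → c' ≤ m + 1 →
        (∀ b, t ≤ b → b < c' → ℓ b = []) → (c' ≤ m → ℓ c' ≠ []) →
        (∀ r, r < 4 ∨ r = 17 → s₁.reg r = s.reg r) → s₁.reg 15 = t → s₁.reg 16 = c' →
        s₁.mem = Function.update s.mem (4 * t + 7) c →
        s₁.cells ≤ 8 * n + 16 → s₁.time ≤ s.time + 11 →
        Ends w e (.loop (.le 2 15)
          (.sub 15 15 2 ;; .mul 14 15 3 ;; .add 14 14 3 ;; .add 14 14 2 ;; .load 8 14 ;;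
            .add 14 14 2 ;; .add 14 14 2 ;; .store 14 16 ;; .cond (.le 2 8) (.add 16 15 17) .skip))
          s₁ fun s' => (∀ b < t + 1, IsNext ℓ m b (s'.mem (4 * b + 7))) ∧
            (∀ a, (∀ b < t + 1, a ≠ 4 * b + 7) → s'.mem a = s.mem a) ∧
            s'.time ≤ s.time + (11 * (t + 1) + 1) ∧ s'.cells ≤ 8 * n + 16 := by
      intro s₁ c' k1 k2 k3 k4 kreg k15 k16 kmem kc kt
      refine (ih c' (by omega) k1 k2 k3 k4 s₁ (hs.congr kreg) k15 k16 (fun b hb => ?_) kc).mono ?_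
      · rw [kmem, Function.update_of_ne (by omega), hlen b hb]
      · rintro s' ⟨z1, z2, z3, z4⟩
        refine ⟨fun b hb => ?_, fun a ha => ?_, by omega, z4⟩
        · rcases Nat.lt_succ_iff_lt_or_eq.1 hb with hb | rfl
          · exact z1 b hb
          · rw [z2 _ (by omega), kmem, Function.update_self]
            exact ⟨by omega, hcm, fun b' h h' => hempty b' (by omega) h', hfull⟩
        · rw [z2 a fun b hb => ha b (by omega), kmem,
            Function.update_of_ne (ha t t.lt_succ_self)]
    generalize (fun s' : State => _ ∧ _) = P at key ⊢
    generalize hcmd : Cmd.loop _ _ = cmd at key ⊢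
    simp [ends_seq, ends_cond, ends_load, ends_store, ends_add, ends_sub, ends_mul,
      ends_skip, State.tick, State.touch, State.set, Test.holds, h2, h3, h15, h16, h17, e4, e5, e6,
      e7, hlen t (by omega)]
    refine ⟨by omega, by omega, by omega, by omega, by omega, by omega, fun hL => ⟨by omega, ?_⟩,
      fun hL => ?_⟩
    · refine key _ t le_rfl (by omega) (by omega) (fun _ => ?_) (fun r hr => ?_) ?_ ?_ ?_ ?_ ?_ <;>
        simp
      · rintro h
        simp [h] at hL
      · have : ∀ j, (4 ≤ j ∧ j ≠ 17) → r ≠ j := by omega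
        simp [this]
      · omega
    · refine key _ c (by omega) hcm (fun b hb hb' => ?_) hfull (fun r hr => ?_) ?_ ?_ ?_ ?_ ?_ <;>
        try simp
      · rcases Nat.eq_or_lt_of_le hb with rfl | hb
        · exact hL
        · exact hempty b hb hb'
      · have : ∀ j, (4 ≤ j ∧ j ≠ 17) → r ≠ j := by omega
        simp [this]
      · exact h16
      · omega

theorem ends_link {w : ℕ} {e : Env} {n : ℕ} (hw : 64 * (n + 1) ≤ 2 ^ w) {K m i : ℕ}
    (hm : m ≤ n) {ℓ : ℕ → List ℕ} {s : State} (hs : Std s K m) (hrep : Rep s.mem m i ℓ)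
    (hc : s.cells ≤ 8 * n + 16) :
    Ends w e link s fun s' => Rep s'.mem m i ℓ ∧
      (∀ b ≤ m, IsNext ℓ m b (s'.mem (4 * b + 7))) ∧
      s'.time ≤ s.time + (11 * m + 14) ∧ s'.cells ≤ 8 * n + 16 := by
  rw [link, ends_seq, ends_add, ends_seq, ends_add]
  refine ⟨by rw [hs.r1, hs.r2]; omega, by simp [State.tick, State.set, hs.r1, hs.r2]; omega, ?_⟩
  refine (ends_link_loop hw hm (m + 1) (m + 1) le_rfl le_rfl le_rfl (by omega) (by omega) _
    (hs.congr fun r hr => ?_) ?_ ?_ (by exact hrep.len) ?_).mono ?_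
  · have h1 : r ≠ 15 := by omega
    have h2 : r ≠ 16 := by omega
    simp [State.tick, State.set, h1, h2]
  · simp [State.tick, State.set, hs.r1, hs.r2]
  · simp [State.tick, State.set, hs.r1, hs.r2]
  · simpa [State.tick, State.set] using hc
  · rintro s' ⟨z1, z2, z3, z4⟩
    simp only [State.tick, State.set] at z2 z3
    exact ⟨hrep.congr fun a ha => z2 a fun b hb => ha b (by omega), fun b hb => z1 b (by omega),
      by omega, z4⟩

/-! ### Rebuilding the structure -/

/-- Starts an empty structure with as many intervals as register `1` says. -/
def clear : Cmd :=
  .mul 6 1 3 ;; .add 6 6 3 ;; .add 6 6 3 ;; .store 2 6 ;; .store 17 1 ;; .const 15 0 ;;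
  .loop (.le 15 1)
    (.mul 14 15 3 ;; .add 14 14 3 ;; .store 14 6 ;; .add 14 14 2 ;; .store 14 17 ;;
      .add 14 14 2 ;; .store 14 17 ;; .add 15 15 2)

/-- Here `t` is the number of records that are still to be initialized. -/
theorem ends_clear_loop {w : ℕ} {e : Env} {n : ℕ} (hw : 64 * (n + 1) ≤ 2 ^ w) {K m : ℕ}
    (hm : m ≤ n) (t : ℕ) (ht : t ≤ m + 1) (s : State) (hs : Std s K m)
    (h6 : s.reg 6 = 4 * m + 8) (h15 : s.reg 15 + t = m + 1) (hc : s.cells ≤ 8 * n + 16) :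
    Ends w e (.loop (.le 15 1)
      (.mul 14 15 3 ;; .add 14 14 3 ;; .store 14 6 ;; .add 14 14 2 ;; .store 14 17 ;;
        .add 14 14 2 ;; .store 14 17 ;; .add 15 15 2)) s
      fun s' => (∀ b, s.reg 15 ≤ b → b ≤ m → s'.mem (4 * b + 4) = 4 * m + 8 ∧
          s'.mem (4 * b + 5) = 0 ∧ s'.mem (4 * b + 6) = 0) ∧
        (∀ a, a < 4 * s.reg 15 + 4 → s'.mem a = s.mem a) ∧ Std s' K m ∧
        s'.time ≤ s.time + (9 * t + 1) ∧ s'.cells ≤ 8 * n + 16 := by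
  induction t generalizing s with
  | zero =>
    refine ends_loop_of_not (by simp [Test.holds, hs.r1]; omega) ?_
    exact ⟨by omega, fun _ _ => rfl, hs.congr fun _ _ => rfl, by simp [State.tick], hc⟩
  | succ t ih =>
    obtain ⟨h0, h1, h2, h3, h17⟩ := id hs
    refine ends_loop_of (by simp [Test.holds, h1]; omega) ?_
    generalize hP : (fun s' : State => Ends _ _ _ s' _) = P
    generalize hb : s.reg 15 = b at *
    have e4 : b * 4 + 4 = 4 * b + 4 := by ring
    have e5 : 4 * b + 4 + 1 = 4 * b + 5 := rfl
    have e6 : 4 * b + 5 + 1 = 4 * b + 6 := rfl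
    simp [ends_seq, ends_store, ends_add, ends_mul,
      State.tick, State.touch, State.set, h2, h3, h6, hb, h17, e4, e5, e6]
    subst hP
    refine ⟨by omega, by omega, by omega, by omega, by omega, ?_⟩
    refine (ih (by omega) _ (hs.congr fun r hr => ?_) ?_ ?_ ?_).mono ?_
    · have : ∀ j, (4 ≤ j ∧ j ≠ 17) → r ≠ j := by omega
      simp [this]
    · simpa using h6
    · simp
      omega
    · simp
      omega
    · rintro s' ⟨z1, z2, z3, z4, z5⟩
      simp only [Function.update_self] at z1 z2 z4
      refine ⟨fun b' h h' => ?_, fun a ha => ?_, z3, by omega, z5⟩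
      · rcases Nat.eq_or_lt_of_le h with rfl | h
        · rw [z2 _ (by omega), z2 _ (by omega), z2 _ (by omega)]
          simp
        · exact z1 b' h h'
      · rw [z2 a (by omega)]
        have h4 : a ≠ 4 * b + 4 := by omega
        have h5 : a ≠ 4 * b + 5 := by omega
        have h6 : a ≠ 4 * b + 6 := by omega
        simp [h4, h5, h6]

theorem ends_clear {w : ℕ} {e : Env} {n : ℕ} (hw : 64 * (n + 1) ≤ 2 ^ w) {K m : ℕ} (hm : m ≤ n)
    {s : State} (hs : Std s K m) (hc : s.cells ≤ 8 * n + 16) :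
    Ends w e clear s fun s' => Rep s'.mem m 0 (fun _ => []) ∧ Std s' K m ∧
      s'.time ≤ s.time + (9 * m + 16) ∧ s'.cells ≤ 8 * n + 16 := by
  obtain ⟨h0, h1, h2, h3, h17⟩ := id hs
  generalize hP : (fun s' : State => _ ∧ _) = P
  have key : ∀ s₁ : State, Std s₁ K m → s₁.reg 6 = 4 * m + 8 → s₁.reg 15 = 0 → s₁.mem 0 = m →
      s₁.mem 1 = 4 * m + 8 → s₁.cells ≤ 8 * n + 16 → s₁.time = s.time + 6 →
      Ends w e (.loop (.le 15 1)
        (.mul 14 15 3 ;; .add 14 14 3 ;; .store 14 6 ;; .add 14 14 2 ;; .store 14 17 ;;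
          .add 14 14 2 ;; .store 14 17 ;; .add 15 15 2)) s₁ P := by
    intro s₁ ks k6 k15 km0 km1 kc kt
    refine (ends_clear_loop hw hm (m + 1) le_rfl s₁ ks k6 (by omega) kc).mono ?_
    rintro s' ⟨z1, z2, z3, z4, z5⟩
    rw [← hP]
    rw [k15] at z1 z2
    have z1' : ∀ b ≤ m, _ := fun b hb => z1 b b.zero_le hb
    refine ⟨?_, z3, by omega, z5⟩
    have hm1 : s'.mem 1 = 4 * m + 8 := by rw [z2 1 (by omega), km1]
    constructor
    · rw [z2 0 (by omega), km0]
    · exact fun b hb => (z1' b hb).2.1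
    · exact fun b hb => trivial
    · exact fun b hb => Nat.zero_le _
    · exact fun b hb => (z1' b hb).2.2.le
    · exact fun b hb => (z1' b hb).1.ge
    · intro b hb
      rw [(z1' b hb).1, (z1' b hb).2.2, hm1]
    · intro b hb b' hb' _
      rw [(z1' b hb).1, (z1' b hb).2.2, (z1' b' hb').1]
      exact .inl le_rfl
    · omega
    · simp
    · simp
  simp only [clear]
  generalize Cmd.loop _ _ = cmd at key ⊢
  simp [ends_seq, ends_store, ends_add, ends_mul, ends_const,
    State.tick, State.touch, State.set, h1, h2, h3, h17]
  refine ⟨by omega, by omega, by omega, key _ (hs.congr fun r hr => ?_) ?_ ?_ ?_ ?_ ?_ ?_⟩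
  · have : ∀ j, (4 ≤ j ∧ j ≠ 17) → r ≠ j := by omega
    simp [this]
  all_goals simp
  all_goals omega

/-- Inserts all items. -/
def fill : Cmd :=
  .const 15 1 ;; .loop (.le 15 0) (.sub 4 15 2 ;; insertItem ;; .add 15 15 2)

/-- Here `t` is the number of items that are still to be inserted. -/
theorem ends_fill_loop {w : ℕ} {e : Env} {n : ℕ} (hw : 64 * (n + 1) ≤ 2 ^ w) {K m : ℕ}
    (hm : m ≤ n) (hK : K ≤ n) (hx : ∀ j < K, e.item j ∈ Icc (0 : ℝ) 1) (t i : ℕ) (ht : i + t = K)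
    {ℓ : ℕ → List ℕ} (s : State) (hs : Std s K m) (h15 : s.reg 15 = i + 1)
    (hrep : Rep s.mem m i ℓ) (hgood : Good e.item m i ℓ) (hc : s.cells ≤ 8 * n + 16) :
    Ends w e (.loop (.le 15 0) (.sub 4 15 2 ;; insertItem ;; .add 15 15 2)) s fun s' =>
      ∃ ℓ', Rep s'.mem m K ℓ' ∧ Good e.item m K ℓ' ∧ Std s' K m ∧
        s'.time ≤ s.time +
          (∑ j ∈ Finset.Ico i K, (8 * load e.item m j (bucket m (e.item j)) + 33) + 1) ∧
        s'.cells ≤ 8 * n + 16 := by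
  induction t generalizing s i ℓ with
  | zero =>
    obtain rfl : i = K := by omega
    refine ends_loop_of_not (by simp [Test.holds, hs.r0, h15]) ?_
    exact ⟨ℓ, hrep, hgood, hs.congr fun _ _ => rfl, by simp [State.tick], hc⟩
  | succ t ih =>
    refine ends_loop_of (by simp [Test.holds, hs.r0, h15]; omega) ?_
    rw [ends_seq, ends_sub]
    refine ⟨by simp [State.tick, h15, hs.r2]; omega, ?_⟩
    rw [ends_seq]
    refine (ends_insertItem (K := K) hw (hs.congr fun r hr => ?_) (i := i) (ℓ := ℓ) ?_
      (by exact hrep) hm (by omega)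
      (hx i (by omega)) ?_).mono ?_
    · have : r ≠ 4 := by omega
      simp [State.tick, State.set, this]
    · simp [State.tick, State.set, h15, hs.r2]
    · simpa [State.tick, State.set] using hc
    rintro s₁ ⟨z1, _, _, z4, z5, z6⟩
    have hs₁ : Std s₁ K m := hs.congr fun r hr => by
      rw [z4 r (by omega)]
      have : r ≠ 4 := by omega
      simp [State.tick, State.set, this]
    have h15₁ : s₁.reg 15 = i + 1 := by
      rw [z4 15 (by omega)]
      simpa [State.tick, State.set] using h15
    simp only [State.tick, State.set] at z5
    rw [ends_add]
    refine ⟨by rw [h15₁, hs₁.r2]; omega, ?_⟩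
    refine (ih (i + 1) (by omega) _ (hs₁.congr fun r hr => ?_) ?_ (by exact z1) hgood.insert (by exact z6)).mono ?_
    · have : r ≠ 15 := by omega
      simp [State.tick, State.set, this]
    · simp [State.tick, State.set, h15₁, hs₁.r2]
    · rintro s' ⟨ℓ', y1, y2, y3, y4, y5⟩
      refine ⟨ℓ', y1, y2, y3, ?_, y5⟩
      rw [Finset.sum_eq_sum_Ico_succ_bot (by omega : i < K), ← hgood.length_eq]
      simp only [State.tick, State.set] at y4
      omega

theorem ends_fill {w : ℕ} {e : Env} {n : ℕ} (hw : 64 * (n + 1) ≤ 2 ^ w) {K m : ℕ}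
    (hm : m ≤ n) (hK : K ≤ n) (hx : ∀ j < K, e.item j ∈ Icc (0 : ℝ) 1) {s : State}
    (hs : Std s K m) (hrep : Rep s.mem m 0 (fun _ => [])) (hc : s.cells ≤ 8 * n + 16) :
    Ends w e fill s fun s' =>
      ∃ ℓ', Rep s'.mem m K ℓ' ∧ Good e.item m K ℓ' ∧ Std s' K m ∧
        s'.time ≤ s.time +
          (8 * ∑ j ∈ Finset.range K, load e.item m j (bucket m (e.item j)) + 33 * K + 2) ∧
        s'.cells ≤ 8 * n + 16 := by
  rw [fill, ends_seq, ends_const]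
  refine ⟨by omega, ?_⟩
  refine (ends_fill_loop hw hm hK hx K 0 (by omega) (ℓ := fun _ => []) _
    (hs.congr fun r hr => ?_) ?_ (by exact hrep) (Good.nil _ _) (by exact hc)).mono ?_
  · have : r ≠ 15 := by omega
    simp [State.tick, State.set, this]
  · simp [State.tick, State.set]
  · rintro s' ⟨ℓ', y1, y2, y3, y4, y5⟩
    refine ⟨ℓ', y1, y2, y3, ?_, y5⟩
    rw [← Finset.range_eq_Ico, Finset.sum_add_distrib, ← Finset.mul_sum] at y4
    simp [State.tick, State.set] at y4
    omega

/-- The memory holds the first `k` items in `m + 1` linked buckets. -/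
def Stored (X : ℕ → ℝ) (mem : ℕ → ℕ) (m k : ℕ) : Prop :=
  ∃ ℓ, Rep mem m k ℓ ∧ Good X m k ℓ ∧ ∀ b ≤ m, IsNext ℓ m b (mem (4 * b + 7))

/-! ### Insertion -/

/-- Inserts the newest item.  The structure is rebuilt with `K` intervals when the number `K` of
items has become at least twice the number of intervals. -/
def insertCmd : Cmd :=
  .const 2 1 ;; .const 3 4 ;; .load 1 17 ;; .add 14 1 1 ;;
  .cond (.le 14 0) (.add 1 0 17 ;; clear ;; fill ;; link) (.sub 4 0 2 ;; insertItem ;; relink)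

/-- The number of intervals after `k` insertions. -/
def level : ℕ → ℕ
  | 0 => 0
  | k + 1 => if 2 * level k ≤ k + 1 then k + 1 else level k

/-- A bound for the time of the `K`-th insertion into a structure with `m` intervals. -/
noncomputable def insertCost (X : ℕ → ℝ) (m K : ℕ) : ℕ :=
  if 2 * m ≤ K then 8 * ∑ j ∈ Finset.range K, load X K j (bucket K (X j)) + 60 * K + 60
  else 8 * load X m (K - 1) (bucket m (X (K - 1))) +
    12 * zeroRun (load X m (K - 1)) (bucket m (X (K - 1))) + 60

theorem ends_insertCmd {w : ℕ} {e : Env} {n : ℕ} (hw : 64 * (n + 1) ≤ 2 ^ w) {K m : ℕ}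
    (hK : 1 ≤ K) (hKn : K ≤ n) (hm : m ≤ n) (hx : ∀ j < K, e.item j ∈ Icc (0 : ℝ) 1) {s : State}
    (h0 : s.reg 0 = K) (hr : ∀ r ≠ 0, s.reg r = 0) (hmem : s.mem 0 = m)
    (hst : K < 2 * m → Stored e.item s.mem m (K - 1)) (hc : s.cells ≤ 8 * n + 16) :
    Ends w e insertCmd s fun s' => Stored e.item s'.mem (if 2 * m ≤ K then K else m) K ∧
      s'.time ≤ s.time + insertCost e.item m K ∧ s'.cells ≤ 8 * n + 16 := by
  generalize hP : (fun s' : State => _ ∧ _) = P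
  have key1 : 2 * m ≤ K → ∀ s₁ : State, Std s₁ K K → s₁.time = s.time + 6 →
      s₁.cells ≤ 8 * n + 16 → Ends w e clear s₁ fun s₂ => Ends w e fill s₂ fun s₃ =>
        Ends w e link s₃ P := by
    intro hmK s₁ hs₁ ht₁ hc₁
    refine (ends_clear hw hKn hs₁ hc₁).mono ?_
    rintro s₂ ⟨hrep₂, hs₂, ht₂, hc₂⟩
    refine (ends_fill hw hKn hKn hx hs₂ hrep₂ hc₂).mono ?_
    rintro s₃ ⟨ℓ, hrep₃, hgood, hs₃, ht₃, hc₃⟩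
    refine (ends_link hw hKn hs₃ hrep₃ hc₃).mono ?_
    rintro s₄ ⟨hrep₄, hnext, ht₄, hc₄⟩
    rw [← hP]
    simp only [if_pos hmK, insertCost]
    exact ⟨⟨ℓ, hrep₄, hgood, hnext⟩, by omega, hc₄⟩
  have key2 : ¬ 2 * m ≤ K → ∀ s₁ : State, Std s₁ K m → s₁.reg 4 = K - 1 → s₁.mem = s.mem →
      s₁.time = s.time + 6 → s₁.cells ≤ 8 * n + 16 →
      Ends w e insertItem s₁ fun s₂ => Ends w e relink s₂ P := by
    intro hmK s₁ hs₁ h4 hm₁ ht₁ hc₁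
    obtain ⟨ℓ, hrep, hgood, hnext⟩ := hst (by omega)
    rw [← hm₁] at hrep hnext
    have hxK := hx (K - 1) (by omega)
    refine (ends_insertItem hw hs₁ h4 hrep hm (by omega) hxK hc₁).mono ?_
    rintro s₂ ⟨hrep₂, hmem₂, h5, hreg₂, ht₂, hc₂⟩
    have hne : carry e.item (ℓ (bucket m (e.item (K - 1)))) (K - 1) ≠ [] := by
      rw [← List.length_pos_iff, length_carry]
      omega
    refine (ends_relink hw hm (bucket_le m hxK) hne (hs₁.congr fun r hr => hreg₂ r (by omega)) h5
      hrep₂ (fun b hb => by rw [hmem₂ b hb]; exact hnext b hb) hc₂).mono ?_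
    rintro s₃ ⟨hrep₃, hnext₃, ht₃, hc₃⟩
    rw [← hP]
    have hgood' := hgood.insert
    simp only [hgood.length_eq] at ht₂ ht₃
    rw [show K - 1 + 1 = K by omega] at hrep₃ hgood'
    refine ⟨?_, ?_, hc₃⟩
    · rw [if_neg hmK]
      exact ⟨_, hrep₃, hgood', hnext₃⟩
    · rw [insertCost, if_neg hmK]
      change s₃.time ≤ s₂.time + (12 * zeroRun (load e.item m (K - 1)) _ + 14) at ht₃
      omega
  have hw0 : w ≠ 0 := by
    rintro rfl
    omega
  simp only [insertCmd]
  generalize clear = c1, fill = c2, link = c3, insertItem = c4, relink = c5 at key1 key2 ⊢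
  simp [ends_seq, ends_cond, ends_load, ends_add, ends_sub, ends_const, State.tick, State.touch,
    State.set, Test.holds, hr, h0, hmem, hw0]
  refine ⟨by omega, by omega, fun h => ⟨by omega, key1 (by omega) _ ?_ rfl ?_⟩,
    fun h => ⟨by omega, key2 (by omega) _ ?_ ?_ rfl rfl ?_⟩⟩
  · constructor <;> simp [h0, hr]
  · simp
    omega
  · constructor <;> simp [h0, hr]
  · simp
  · simp
    omega

/-! ### Binary search -/

/-- Loads the bucket of the first query argument and sets register `11` to the number of its items
that are less than this argument.  Register `12` is by one larger than the lower end of the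
search interval. -/
def search : Cmd :=
  .const 2 1 ;; .const 3 4 ;; .const 9 2 ;; .load 1 17 ;; .piece 5 .lo .zero .one 1 ;;
  .mul 6 5 3 ;; .add 6 6 3 ;; .load 7 6 ;; .add 14 6 2 ;; .load 8 14 ;;
  .add 11 8 17 ;; .add 12 2 17 ;;
  .loop (.le 12 11)
    (.add 13 12 11 ;; .div 13 13 9 ;; .add 14 7 13 ;; .sub 14 14 2 ;; .load 15 14 ;;
      .cond (.realLe .lo (.item 15)) (.sub 11 13 2) (.add 12 13 2))

/-- The search interval is `reg 12 - 1, …, reg 11 - 1`, and `f` bounds the number of halvings. -/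
theorem ends_search_loop {w : ℕ} {e : Env} {M : ℕ} (hM : 2 * M < 2 ^ w) {K m : ℕ} {l : List ℕ}
    (hsorted : l.Pairwise fun i j => e.item i ≤ e.item j) (f : ℕ) (s : State) (hs : Std s K m)
    (h9 : s.reg 9 = 2) (hseg : Seg s.mem (s.reg 7) l) (hp : s.reg 7 + l.length + 2 ≤ M)
    (h12 : 1 ≤ s.reg 12) (h1211 : s.reg 12 ≤ s.reg 11 + 1) (h11 : s.reg 11 ≤ l.length)
    (hf : s.reg 11 + 1 < s.reg 12 + 2 ^ f)
    (hlo : ∀ i (h : i < l.length), i + 1 < s.reg 12 → e.item l[i] < e.lo)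
    (hhi : ∀ i (h : i < l.length), s.reg 11 ≤ i → e.lo ≤ e.item l[i]) (hc : s.cells ≤ M) :
    Ends w e (.loop (.le 12 11)
      (.add 13 12 11 ;; .div 13 13 9 ;; .add 14 7 13 ;; .sub 14 14 2 ;; .load 15 14 ;;
        .cond (.realLe .lo (.item 15)) (.sub 11 13 2) (.add 12 13 2))) s
      fun s' => s'.reg 11 ≤ l.length ∧
        (∀ i (h : i < l.length), i < s'.reg 11 → e.item l[i] < e.lo) ∧
        (∀ i (h : i < l.length), s'.reg 11 ≤ i → e.lo ≤ e.item l[i]) ∧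
        (∀ r, r ≤ 10 ∨ 16 ≤ r → s'.reg r = s.reg r) ∧ s'.mem = s.mem ∧ s'.out = s.out ∧
        s'.time ≤ s.time + (8 * f + 1) ∧ s'.cells ≤ M := by
  induction f generalizing s with
  | zero =>
    refine ends_loop_of_not (by simp [Test.holds]; omega) ?_
    refine ⟨h11, fun i h hi => hlo i h ?_, hhi, fun _ _ => rfl, rfl, rfl, by simp [State.tick], hc⟩
    simp only [State.tick] at hi
    omega
  | succ f ih =>
    by_cases hle : s.reg 12 ≤ s.reg 11
    swap
    · refine ends_loop_of_not (by simpa [Test.holds] using hle) ?_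
      refine ⟨h11, fun i h hi => hlo i h ?_, hhi, fun _ _ => rfl, rfl, rfl, by simp [State.tick],
        hc⟩
      simp only [State.tick] at hi
      omega
    obtain ⟨h0, h1, h2, h3, h17⟩ := id hs
    refine ends_loop_of (by simpa [Test.holds] using hle) ?_
    obtain ⟨d, hd⟩ : ∃ d, (s.reg 12 + s.reg 11) / 2 = d + 1 :=
      ⟨(s.reg 12 + s.reg 11) / 2 - 1, by omega⟩
    have hdl : d < l.length := by omega
    have hload : s.mem (s.reg 7 + d) = l[d] := hseg.get hdl
    have hpow : 2 ^ (f + 1) = 2 * 2 ^ f := by ring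
    generalize hP : (fun s' : State => Ends _ _ _ s' _) = P
    have e7 : s.reg 7 + (d + 1) - 1 = s.reg 7 + d := by omega
    simp [ends_seq, ends_cond, ends_load, ends_add, ends_sub, ends_div, State.tick,
      State.touch, State.set, Test.holds, RealOp.val, h2, h9, hd, e7, hload]
    subst hP
    have mono := List.pairwise_iff_getElem.1 hsorted
    refine ⟨by omega, by omega, by omega, by omega, fun hq => ⟨by omega, ?_⟩,
      fun hq => ⟨by omega, ?_⟩⟩
    · refine (ih _ (hs.congr fun r hr => ?_) ?_ (by exact hseg) ?_ ?_ ?_ ?_ ?_ ?_ ?_ ?_).mono ?_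
      · have : ∀ j, 11 ≤ j → j ≤ 15 → r ≠ j := by omega
        simp [this]
      · simpa using h9
      · simpa using hp
      · simpa using h12
      · simp
        omega
      · simp
        omega
      · simp
        omega
      · simpa using hlo
      · simp only [Function.update_self]
        intro i h hi
        rcases Nat.eq_or_lt_of_le hi with rfl | hi
        · exact hq
        · exact hq.trans (mono d i hdl h hi)
      · simp
        omega
      · rintro s' ⟨z1, z2, z3, z4, z5, z6, z7, z8⟩
        refine ⟨z1, z2, z3, fun r hr => ?_, z5, z6, by simp at z7; omega, z8⟩
        rw [z4 r hr]
        have : ∀ j, 11 ≤ j → j ≤ 15 → r ≠ j := by omega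
        simp [this]
    · refine (ih _ (hs.congr fun r hr => ?_) ?_ (by exact hseg) ?_ ?_ ?_ ?_ ?_ ?_ ?_ ?_).mono ?_
      · have : ∀ j, 11 ≤ j → j ≤ 15 → r ≠ j := by omega
        simp [this]
      · simpa using h9
      · simpa using hp
      · simp
      · simp
        omega
      · simpa using h11
      · simp
        omega
      · simp only [Function.update_self]
        intro i h hi
        rcases Nat.eq_or_lt_of_le (show i ≤ d by omega) with rfl | hi
        · exact hq
        · exact (mono i d h hdl hi).trans_lt hq
      · simpa using hhi
      · simp
        omega
      · rintro s' ⟨z1, z2, z3, z4, z5, z6, z7, z8⟩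
        refine ⟨z1, z2, z3, fun r hr => ?_, z5, z6, by simp at z7; omega, z8⟩
        rw [z4 r hr]
        have : ∀ j, 11 ≤ j → j ≤ 15 → r ≠ j := by omega
        simp [this]

theorem ends_search {w : ℕ} {e : Env} {n : ℕ} (hw : 64 * (n + 1) ≤ 2 ^ w) {k m : ℕ}
    (hkn : k ≤ n) (hm : m ≤ n) (hq : e.lo ∈ Icc (0 : ℝ) 1) {s : State}
    (h0 : s.reg 0 = k) (hr : ∀ r ≠ 0, s.reg r = 0) {ℓ : ℕ → List ℕ} (hrep : Rep s.mem m k ℓ)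
    (hgood : Good e.item m k ℓ) (hc : s.cells ≤ 8 * n + 16) :
    Ends w e search s fun s' => Std s' k m ∧ s'.reg 5 = bucket m e.lo ∧
      s'.reg 7 = s.mem (4 * bucket m e.lo + 4) ∧ s'.reg 8 = (ℓ (bucket m e.lo)).length ∧
      s'.reg 11 ≤ (ℓ (bucket m e.lo)).length ∧
      (∀ i (h : i < (ℓ (bucket m e.lo)).length), i < s'.reg 11 →
        e.item (ℓ (bucket m e.lo))[i] < e.lo) ∧
      (∀ i (h : i < (ℓ (bucket m e.lo)).length), s'.reg 11 ≤ i →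
        e.lo ≤ e.item (ℓ (bucket m e.lo))[i]) ∧
      s'.mem = s.mem ∧ s'.out = s.out ∧
      s'.time ≤ s.time + (8 * (load e.item m k (bucket m e.lo)).size + 13) ∧
      s'.cells ≤ 8 * n + 16 := by
  have hB := bucket_le m hq
  rw [← hgood.length_eq]
  have hsorted := hgood.sorted (bucket m e.lo)
  generalize hBd : bucket m e.lo = B at *
  have hfl : ⌊(m : ℝ) * e.lo⌋₊ = B := hBd
  have q0 := hrep.num
  have q1 := hrep.len B hB
  have q2 := hrep.len_le B hB
  have q5 := hrep.top B hB
  have q6 := hrep.top_le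
  have q7 := hrep.seg B hB
  have e4 : B * 4 + 4 = 4 * B + 4 := by ring
  have e5 : 4 * B + 4 + 1 = 4 * B + 5 := rfl
  generalize hP : (fun s' : State => Std s' k m ∧ _) = P
  have key : ∀ s₁ : State, (∀ r, r ≤ 10 ∨ 16 ≤ r → s₁.reg r =
      if r = 0 then k else if r = 1 then m else if r = 2 then 1 else if r = 3 then 4 else
      if r = 5 then B else if r = 6 then 4 * B + 4 else if r = 7 then s.mem (4 * B + 4) else
      if r = 8 then (ℓ B).length else if r = 9 then 2 else 0) → s₁.reg 11 = (ℓ B).length →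
      s₁.reg 12 = 1 → s₁.mem = s.mem → s₁.out = s.out → s₁.time = s.time + 12 →
      s₁.cells ≤ 8 * n + 16 →
      Ends w e (.loop (.le 12 11)
        (.add 13 12 11 ;; .div 13 13 9 ;; .add 14 7 13 ;; .sub 14 14 2 ;; .load 15 14 ;;
          .cond (.realLe .lo (.item 15)) (.sub 11 13 2) (.add 12 13 2))) s₁ P := by
    intro s₁ kreg k11 k12 kmem kout kt kc
    have hs₁ : Std s₁ k m := by
      constructor <;> rw [kreg _ (by omega)] <;> simp
    have k7 : s₁.reg 7 = s.mem (4 * B + 4) := by rw [kreg _ (by omega)]; simp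
    have k5 : s₁.reg 5 = B := by rw [kreg _ (by omega)]; simp
    have k8 : s₁.reg 8 = (ℓ B).length := by rw [kreg _ (by omega)]; simp
    refine (ends_search_loop (M := 8 * n + 16) (by omega) hsorted (ℓ B).length.size s₁ hs₁ ?_ ?_ ?_
      (by omega) (by omega) (by omega) ?_ (by omega) (fun i h hi => by omega) kc).mono ?_
    · rw [kreg _ (by omega)]
      simp
    · rwa [k7, kmem]
    · omega
    · have := Nat.lt_size_self (ℓ B).length
      omega
    · rintro s' ⟨z1, z2, z3, z4, z5, z6, z7, z8⟩
      rw [← hP]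
      refine ⟨hs₁.congr fun r hr => z4 r (by omega), ?_, ?_, ?_, z1, z2, z3, z5.trans kmem,
        z6.trans kout, by omega, z8⟩
      · rw [z4 _ (by omega), k5]
      · rw [z4 _ (by omega), k7]
      · rw [z4 _ (by omega), k8]
  have hw0 : w ≠ 0 := by
    rintro rfl
    omega
  simp only [search]
  generalize Cmd.loop _ _ = cmd at key ⊢
  simp [ends_seq, ends_load, ends_add, ends_mul, ends_piece, ends_const, State.tick, State.touch,
    State.set, RealOp.val, hr, q0, hfl, e4, e5, q1, hw0]
  refine ⟨by omega, by omega, by omega, by omega, by omega, by omega, by omega,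
    key _ (fun r hr' => ?_) ?_ ?_ ?_ ?_ ?_ ?_⟩ <;> try simp
  · have : ∀ j, 11 ≤ j → j ≤ 15 → r ≠ j := by omega
    have h17 : r = 0 ∨ r ≠ 0 ∧ s.reg r = 0 := by
      by_cases h : r = 0
      · exact .inl h
      · exact .inr ⟨h, hr r h⟩
    rcases h17 with rfl | ⟨h, h'⟩
    · simp [h0]
    · simp only [Function.update_apply, this 11 le_rfl (by norm_num), this 12 (by norm_num)
        (by norm_num), this 14 (by norm_num) (by norm_num), h, h', if_false]
      split_ifs <;> first | rfl | omega
  · omega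

/-! ### Queries -/

/-- Exact match query. -/
def findCmd : Cmd :=
  search ;; .add 12 11 2 ;;
  .cond (.le 12 8)
    (.add 14 7 11 ;; .load 15 14 ;; .cond (.realLe (.item 15) .lo) (.emit 15) .skip)
    .skip

theorem ends_findCmd {w : ℕ} {e : Env} {n : ℕ} (hw : 64 * (n + 1) ≤ 2 ^ w) {k m : ℕ}
    (hkn : k ≤ n) (hm : m ≤ n) (hq : e.lo ∈ Icc (0 : ℝ) 1) {s : State}
    (h0 : s.reg 0 = k) (hr : ∀ r ≠ 0, s.reg r = 0) (hout : s.out = [])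
    (hst : Stored e.item s.mem m k) (hc : s.cells ≤ 8 * n + 16) :
    Ends w e findCmd s fun s' => s'.mem = s.mem ∧
      ((∃ j < k, e.item j = e.lo ∧ s'.out = [j]) ∨
        ((∀ j < k, e.item j ≠ e.lo) ∧ s'.out = [])) ∧
      s'.time ≤ s.time + (8 * (load e.item m k (bucket m e.lo)).size + 20) ∧
      s'.cells ≤ 8 * n + 16 := by
  obtain ⟨ℓ, hrep, hgood, -⟩ := hst
  rw [findCmd, ends_seq]
  refine (ends_search hw hkn hm hq h0 hr hrep hgood hc).mono ?_
  rintro s₁ ⟨hs, -, h7, h8, h11, hlo, hhi, hmem, hout₁, ht, hc₁⟩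
  have hB := bucket_le m hq
  have q2 := hrep.len_le _ hB
  have q5 := hrep.top _ hB
  have q6 := hrep.top_le
  have hseg := hrep.seg _ hB
  have hmemB := hgood.mem_iff (bucket m e.lo)
  have hsorted := List.pairwise_iff_getElem.1 (hgood.sorted (bucket m e.lo))
  have hitem : ∀ j < k, e.item j = e.lo → j ∈ ℓ (bucket m e.lo) := fun j hj h =>
    (hmemB j).2 ⟨hj, by rw [h]⟩
  generalize ℓ (bucket m e.lo) = l at *
  rw [← h7] at hseg q5
  rw [← hmem] at hseg
  rw [hout] at hout₁
  obtain ⟨-, -, h2, -, -⟩ := hs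
  simp only [ends_seq, ends_cond, ends_add, ends_load, ends_emit, ends_skip]
  simp [State.tick, State.touch, State.set, Test.holds, RealOp.val, h2, h8, hmem, hout₁]
  refine ⟨by omega, fun h => ⟨by omega, ?_⟩, fun h => ⟨fun j hj hjq => ?_, by omega, hc₁⟩⟩
  · have hload := hseg.get (i := s₁.reg 11) (by omega)
    rw [hmem] at hload
    simp only [hload]
    refine ⟨fun hle => ⟨⟨?_, le_antisymm hle (hhi _ h le_rfl)⟩, by omega, by omega, by omega⟩,
      fun hlt => ⟨fun j hj hjq => ?_, by omega, by omega, by omega⟩⟩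
    · exact ((hmemB _).1 (List.getElem_mem _)).1
    · obtain ⟨i, hi, rfl⟩ := List.mem_iff_getElem.1 (hitem j hj hjq)
      rcases lt_trichotomy i (s₁.reg 11) with hi' | hi' | hi'
      · exact (hlo i hi hi').ne hjq
      · simp only [← hi'] at hlt
        exact hlt.ne' hjq
      · exact absurd hjq ((hlt.trans_le (hsorted _ i h hi hi')).ne')
  · obtain ⟨i, hi, rfl⟩ := List.mem_iff_getElem.1 (hitem j hj hjq)
    exact (hlo i hi (by omega)).ne hjq

/-- The items in the buckets after `b`. -/
def rest (ℓ : ℕ → List ℕ) (m b : ℕ) : List ℕ := (List.range' (b + 1) (m - b)).flatMap ℓ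

theorem IsNext.rest_eq {ℓ : ℕ → List ℕ} {m b c : ℕ} (h : IsNext ℓ m b c) :
    rest ℓ m b = if c ≤ m then ℓ c ++ rest ℓ m c else [] := by
  obtain ⟨h1, h2, h3, -⟩ := h
  have hsplit : List.range' (b + 1) (m - b) =
      List.range' (b + 1) (c - 1 - b) ++ List.range' c (m + 1 - c) := by
    have := List.range'_append_1 (s := b + 1) (m := c - 1 - b) (n := m + 1 - c)
    rw [show b + 1 + (c - 1 - b) = c by omega, show c - 1 - b + (m + 1 - c) = m - b by omega] at this
    exact this.symm
  have hnil : (List.range' (b + 1) (c - 1 - b)).flatMap ℓ = [] := by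
    rw [List.flatMap_eq_nil_iff]
    intro b' hb'
    rw [List.mem_range'_1] at hb'
    exact h3 b' (by omega) (by omega)
  rw [rest, hsplit, List.flatMap_append, hnil, List.nil_append]
  split_ifs with hc
  · rw [show m + 1 - c = (m - c) + 1 by omega, List.range'_succ, List.flatMap_cons, rest]
  · rw [show m + 1 - c = 0 by omega]
    rfl

/-- Range query.  The loop stops at the first item that is too large, by setting the bucket to
`m + 1`, or when there is no further nonempty bucket. -/
def rangeCmd : Cmd :=
  search ;;
  .loop (.le 5 1)
    (.add 12 11 2 ;;
      .cond (.le 12 8)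
        (.add 14 7 11 ;; .load 15 14 ;;
          .cond (.realLe (.item 15) .hi) (.emit 15 ;; .add 11 11 2) (.add 5 1 2))
        (.mul 6 5 3 ;; .add 6 6 3 ;; .add 6 6 3 ;; .sub 6 6 2 ;; .load 5 6 ;;
          .mul 6 5 3 ;; .add 6 6 3 ;; .load 7 6 ;; .add 6 6 2 ;; .load 8 6 ;; .const 11 0))

open Classical in
/-- Each reported item pays for two rounds: one that reports it, and one that may have to follow a
link before the next item is seen.  Links lead to nonempty buckets, so no two rounds in succession
follow a link. -/
theorem ends_range_loop {w : ℕ} {e : Env} {n : ℕ} (hw : 64 * (n + 1) ≤ 2 ^ w) {K m k : ℕ}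
    (hkn : k ≤ n) (hm : m ≤ n) {mem : ℕ → ℕ} {ℓ : ℕ → List ℕ} (hrep : Rep mem m k ℓ)
    (hnext : ∀ b ≤ m, IsNext ℓ m b (mem (4 * b + 7))) (f : ℕ) (s : State) (hs : Std s K m)
    (b pos : ℕ) (hb : b ≤ m) (h5 : s.reg 5 = b) (h7 : s.reg 7 = mem (4 * b + 4))
    (h8 : s.reg 8 = (ℓ b).length) (h11 : s.reg 11 = pos) (hpos : pos ≤ (ℓ b).length)
    (hf : ((ℓ b).drop pos ++ rest ℓ m b).length + (m - b) ≤ f)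
    (hmem : s.mem = mem) (hc : s.cells ≤ 8 * n + 16) :
    Ends w e (.loop (.le 5 1)
      (.add 12 11 2 ;;
        .cond (.le 12 8)
          (.add 14 7 11 ;; .load 15 14 ;;
            .cond (.realLe (.item 15) .hi) (.emit 15 ;; .add 11 11 2) (.add 5 1 2))
          (.mul 6 5 3 ;; .add 6 6 3 ;; .add 6 6 3 ;; .sub 6 6 2 ;; .load 5 6 ;;
            .mul 6 5 3 ;; .add 6 6 3 ;; .load 7 6 ;; .add 6 6 2 ;; .load 8 6 ;; .const 11 0))) s
      fun s' => s'.out = s.out ++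
          ((ℓ b).drop pos ++ rest ℓ m b).takeWhile (fun j => e.item j ≤ e.hi) ∧
        s'.mem = mem ∧
        s'.time ≤ s.time + (28 * (((ℓ b).drop pos ++ rest ℓ m b).takeWhile
          (fun j => e.item j ≤ e.hi)).length + (if pos < (ℓ b).length then 14 else 28) + 1) ∧
        s'.cells ≤ 8 * n + 16 := by
  induction f using Nat.strong_induction_on generalizing s b pos with
  | _ f ih =>
    obtain ⟨h0, h1, h2, h3, h17⟩ := id hs
    refine ends_loop_of (by simpa [Test.holds, h1, h5] using hb) ?_
    have q1 := hrep.len_le b hb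
    have q2 := hrep.top b hb
    have q3 := hrep.top_le
    have hnb := hnext b hb
    have e4 : b * 4 + 4 = 4 * b + 4 := by ring
    have e7 : 4 * b + 4 + 4 - 1 = 4 * b + 7 := rfl
    by_cases hlt : pos < (ℓ b).length
    · have hload : mem (mem (4 * b + 4) + pos) = (ℓ b)[pos] := (hrep.seg b hb).get hlt
      rw [List.drop_eq_getElem_cons hlt] at hf ⊢
      rw [List.cons_append] at hf ⊢
      by_cases hle : e.item (ℓ b)[pos] ≤ e.hi
      · rw [List.takeWhile_cons_of_pos (by simpa using hle)]
        generalize hP : (fun s' : State => Ends _ _ _ s' _) = P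
        simp [ends_seq, ends_cond, ends_load, ends_add, ends_emit, State.tick,
          State.touch, State.set, Test.holds, RealOp.val, h2, h7, h8, h11, hmem, hload, hle, hlt]
        subst hP
        refine ⟨by omega, by omega, by omega, ?_⟩
        refine (ih (f - 1) (by simp at hf; omega) _ (hs.congr fun r hr => ?_) b (pos + 1) hb ?_ ?_ ?_
          ?_ (by omega) ?_ rfl ?_).mono ?_
        · have : ∀ j, (4 ≤ j ∧ j ≠ 17) → r ≠ j := by omega
          simp [this]
        · simpa using h5
        · simpa using h7
        · simpa using h8
        · simp
        · simp only [List.length_cons] at hf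
          omega
        · simp
          omega
        · rintro s' ⟨z1, z2, z3, z4⟩
          refine ⟨by simpa using z1, z2, ?_, z4⟩
          simp only [List.length_cons, if_pos hlt]
          split_ifs at z3 <;> simp at z3 <;> omega
      · rw [List.takeWhile_cons_of_neg (by simpa using hle)]
        generalize hP : (fun s' : State => Ends _ _ _ s' _) = P
        simp [ends_seq, ends_cond, ends_load, ends_add, State.tick,
          State.touch, State.set, Test.holds, RealOp.val, h1, h2, h7, h8, h11, hmem, hload, hle, hlt]
        subst hP
        refine ⟨by omega, by omega, fun _ => ⟨by omega, ?_⟩⟩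
        refine ends_loop_of_not (by simp [Test.holds, h1]) ?_
        refine ⟨by simp [State.tick], rfl, ?_, ?_⟩
        · simp [State.tick, hlt]
        · simp [State.tick]
          omega
    · obtain rfl : pos = (ℓ b).length := by omega
      rw [List.drop_length, List.nil_append] at hf ⊢
      rw [hnb.rest_eq] at hf ⊢
      obtain ⟨c1, c2, c3, c4⟩ := hnb
      generalize hcd : mem (4 * b + 7) = c at *
      have e4' : c * 4 + 4 = 4 * c + 4 := by ring
      have e5' : 4 * c + 4 + 1 = 4 * c + 5 := rfl
      generalize hP : (fun s' : State => Ends _ _ _ s' _) = P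
      simp [ends_seq, ends_cond, ends_load, ends_add, ends_sub, ends_mul, ends_const, State.tick,
        State.touch, State.set, Test.holds, h2, h3, h5, h8, h11, hmem, e4, e7, hcd, e4', e5']
      subst hP
      refine ⟨by omega, by omega, by omega, by omega, by omega, by omega, by omega, by omega, ?_⟩
      split_ifs at hf ⊢ with hcm
      · have hlc := hrep.len c hcm
        have hne := List.length_pos_iff.2 (c4 hcm)
        refine (ih (f - 1) (by omega) _ (hs.congr fun r hr => ?_) c 0 hcm ?_ ?_ ?_
          ?_ (by omega) ?_ rfl ?_).mono ?_
        · have : ∀ j, (4 ≤ j ∧ j ≠ 17) → r ≠ j := by omega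
          simp [this]
        · simp
        · simp
        · simpa using hlc
        · simp
        · rw [List.drop_zero]
          omega
        · simp
          omega
        · rintro s' ⟨z1, z2, z3, z4⟩
          rw [List.drop_zero] at z1 z3
          rw [if_pos hne] at z3
          exact ⟨z1, z2, by simp at z3 ⊢; omega, z4⟩
      · refine ends_loop_of_not (by simp [Test.holds, h1]; omega) ?_
        refine ⟨by simp [State.tick], rfl, ?_, ?_⟩
        · simp [State.tick]
        · simp [State.tick]
          omega

theorem mem_takeWhile_of_pairwise {α : Type*} (f : α → ℝ) (t : ℝ) {l : List α}
    (h : l.Pairwise fun i j => f i ≤ f j) [DecidablePred fun j => f j ≤ t] (j : α) :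
    j ∈ l.takeWhile (fun j => f j ≤ t) ↔ j ∈ l ∧ f j ≤ t := by
  induction l with
  | nil => simp
  | cons u l ih =>
    rw [List.pairwise_cons] at h
    by_cases hu : f u ≤ t
    · rw [List.takeWhile_cons_of_pos (by simpa using hu), List.mem_cons, ih h.2, List.mem_cons]
      constructor
      · rintro (rfl | h)
        · exact ⟨.inl rfl, hu⟩
        · exact ⟨.inr h.1, h.2⟩
      · rintro ⟨rfl | h, h'⟩
        · exact .inl rfl
        · exact .inr ⟨h, h'⟩
    · rw [List.takeWhile_cons_of_neg (by simpa using hu)]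
      simp only [List.not_mem_nil, List.mem_cons, false_iff, not_and]
      rintro (rfl | hj) hle
      · exact hu hle
      · exact hu ((h.1 j hj).trans hle)

theorem ends_rangeCmd {w : ℕ} {e : Env} {n : ℕ} (hw : 64 * (n + 1) ≤ 2 ^ w) {k m : ℕ}
    (hkn : k ≤ n) (hm : m ≤ n) (hx : ∀ j < k, e.item j ∈ Icc (0 : ℝ) 1)
    (hq : e.lo ∈ Icc (0 : ℝ) 1) {s : State}
    (h0 : s.reg 0 = k) (hr : ∀ r ≠ 0, s.reg r = 0) (hout : s.out = [])
    (hst : Stored e.item s.mem m k) (hc : s.cells ≤ 8 * n + 16) :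
    Ends w e rangeCmd s fun s' => s'.mem = s.mem ∧ s'.out.Nodup ∧
      (∀ j, j ∈ s'.out ↔ j < k ∧ e.lo ≤ e.item j ∧ e.item j ≤ e.hi) ∧
      s'.time ≤ s.time + (8 * (load e.item m k (bucket m e.lo)).size + 28 * s'.out.length + 42) ∧
      s'.cells ≤ 8 * n + 16 := by
  classical
  obtain ⟨ℓ, hrep, hgood, hnext⟩ := hst
  rw [rangeCmd, ends_seq]
  refine (ends_search hw hkn hm hq h0 hr hrep hgood hc).mono ?_
  rintro s₁ ⟨hs, h5, h7, h8, h11, hlo, hhi, hmem, hout₁, ht, hc₁⟩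
  have hB := bucket_le m hq
  refine (ends_range_loop hw hkn hm hrep hnext _ s₁ hs _ _ hB h5 h7 h8 rfl h11 le_rfl hmem hc₁).mono
    ?_
  rintro s' ⟨z1, z2, z3, z4⟩
  rw [hout₁, hout, List.nil_append] at z1
  rw [← z1] at z3
  set B := bucket m e.lo with hBd
  have hmemrest : ∀ j, j ∈ rest ℓ m B ↔ j < k ∧ B < bucket m (e.item j) := by
    intro j
    simp only [rest, List.mem_flatMap, List.mem_range'_1, hgood.mem_iff]
    constructor
    · rintro ⟨b, hb, hj, rfl⟩
      exact ⟨hj, by omega⟩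
    · rintro ⟨hj, hb⟩
      have := bucket_le m (hx j hj)
      exact ⟨_, by omega, hj, rfl⟩
  have hlt : ∀ j, B < bucket m (e.item j) → e.lo < e.item j := fun j hj =>
    lt_of_not_ge fun hle => (bucket_mono m hle).not_gt hj
  have hmemdrop : ∀ j, j ∈ (ℓ B).drop (s₁.reg 11) ↔
      j < k ∧ bucket m (e.item j) = B ∧ e.lo ≤ e.item j := by
    intro j
    rw [List.mem_drop_iff_getElem]
    constructor
    · rintro ⟨i, hi, rfl⟩
      have := (hgood.mem_iff B ((ℓ B)[s₁.reg 11 + i])).1 (List.getElem_mem _)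
      exact ⟨this.1, this.2, hhi _ _ (by omega)⟩
    · rintro ⟨hj, hjB, hle⟩
      obtain ⟨i, hi, rfl⟩ := List.mem_iff_getElem.1 ((hgood.mem_iff B j).2 ⟨hj, hjB⟩)
      have : s₁.reg 11 ≤ i := by
        by_contra hcon
        exact (hlo i hi (by omega)).not_ge hle
      refine ⟨i - s₁.reg 11, by omega, ?_⟩
      congr 1
      omega
  have hmemL : ∀ j, j ∈ (ℓ B).drop (s₁.reg 11) ++ rest ℓ m B ↔ j < k ∧ e.lo ≤ e.item j := by
    intro j
    rw [List.mem_append, hmemdrop, hmemrest]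
    constructor
    · rintro (h | h)
      · exact ⟨h.1, h.2.2⟩
      · exact ⟨h.1, (hlt j h.2).le⟩
    · rintro ⟨hj, hle⟩
      rcases (bucket_mono m hle).eq_or_lt with h | h
      · exact .inl ⟨hj, h.symm, hle⟩
      · exact .inr ⟨hj, h⟩
  have hsorted : ((ℓ B).drop (s₁.reg 11) ++ rest ℓ m B).Pairwise
      fun i j => i ≠ j ∧ e.item i ≤ e.item j := by
    have hmono : ∀ i j, bucket m (e.item i) < bucket m (e.item j) →
        i ≠ j ∧ e.item i ≤ e.item j := by
      intro i j h
      refine ⟨?_, le_of_not_ge fun hle => (bucket_mono m hle).not_gt h⟩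
      rintro rfl
      exact lt_irrefl _ h
    have hone : ∀ b, (ℓ b).Pairwise fun i j => i ≠ j ∧ e.item i ≤ e.item j := fun b =>
      (hgood.nodup b).and (hgood.sorted b)
    rw [List.pairwise_append]
    refine ⟨(hone B).sublist (List.drop_sublist _ _), ?_, fun i hi j hj => hmono i j ?_⟩
    · rw [rest, List.pairwise_flatMap]
      refine ⟨fun b _ => hone b, ?_⟩
      refine (List.pairwise_lt_range' (s := B + 1) (n := m - B)).imp ?_
      intro b b' hbb' i hi j hj
      apply hmono
      rwa [((hgood.mem_iff b i).1 hi).2, ((hgood.mem_iff b' j).1 hj).2]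
    · rw [((hmemdrop i).1 hi).2.1]
      exact ((hmemrest j).1 hj).2
  refine ⟨z2.trans rfl, ?_, fun j => ?_, ?_, z4⟩
  · rw [z1]
    exact (hsorted.imp fun h => h.1).sublist (List.takeWhile_sublist _)
  · rw [z1, mem_takeWhile_of_pairwise _ _ (hsorted.imp fun h => h.2), hmemL, and_assoc]
  · split_ifs at z3 <;> omega

/-! ### The index -/

/-- The index: a bucket structure with sorted buckets and links between nonempty buckets. -/
def bucketIndex : Index := ⟨insertCmd, findCmd, rangeCmd⟩

/-- Words of `7 * n.size` bits hold all addresses and intermediate results. -/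
theorem word_size {n : ℕ} (hn : 1 ≤ n) : 64 * (n + 1) ≤ 2 ^ (7 * n.size) := by
  have h1 : n + 1 ≤ 2 ^ n.size := Nat.lt_size_self n
  have h2 : 2 ^ 6 ≤ 2 ^ (6 * n.size) := by
    have := Nat.size_pos.2 hn
    exact Nat.pow_le_pow_right (by norm_num) (by omega)
  calc 64 * (n + 1) ≤ 2 ^ (6 * n.size) * 2 ^ n.size := Nat.mul_le_mul h2 h1
    _ = 2 ^ (7 * n.size) := by rw [← pow_add]; congr 1; ring

/-- The data set as a sequence, continued by `0`. -/
def extend {n : ℕ} (x : Fin n → ℝ) (j : ℕ) : ℝ := if h : j < n then x ⟨j, h⟩ else 0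

theorem env_item {n : ℕ} (x : Fin n → ℝ) {k j : ℕ} (lo hi : ℝ) (hj : j < k) :
    (env x k lo hi).item j = extend x j := by
  simp [env, extend, hj]

theorem extend_mem {n : ℕ} {x : Fin n → ℝ} (hx : ∀ i, x i ∈ Icc (0 : ℝ) 1) (j : ℕ) :
    extend x j ∈ Icc (0 : ℝ) 1 := by
  unfold extend
  split_ifs
  · exact hx _
  · exact ⟨le_rfl, zero_le_one⟩

theorem load_congr {X Y : ℕ → ℝ} {i : ℕ} (h : ∀ j < i, X j = Y j) (m : ℕ) :
    load X m i = load Y m i := by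
  classical
  funext b
  unfold load
  congr 1
  refine Finset.filter_congr fun j hj => ?_
  rw [h j (Finset.mem_range.1 hj)]

theorem insertCost_congr {X Y : ℕ → ℝ} {K : ℕ} (hK : 1 ≤ K) (h : ∀ j < K, X j = Y j) (m : ℕ) :
    insertCost X m K = insertCost Y m K := by
  unfold insertCost
  rw [load_congr (fun j hj => h j (by omega) : ∀ j < K - 1, X j = Y j), h (K - 1) (by omega)]
  congr 4
  refine Finset.sum_congr rfl fun j hj => ?_
  rw [Finset.mem_range] at hj
  rw [load_congr (fun j' hj' => h j' (by omega) : ∀ j' < j, X j' = Y j'), h j hj]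

theorem Stored.congr {X Y : ℕ → ℝ} {mem : ℕ → ℕ} {m k : ℕ} (h : Stored X mem m k)
    (hXY : ∀ j < k, X j = Y j) : Stored Y mem m k := by
  obtain ⟨ℓ, h1, h2, h3⟩ := h
  exact ⟨ℓ, h1, h2.congr hXY, h3⟩

theorem level_le (k : ℕ) : level k ≤ k := by
  induction k with
  | zero => exact le_rfl
  | succ k ih =>
    rw [level]
    split_ifs <;> omega

theorem lt_level {k : ℕ} (hk : 1 ≤ k) : k < 2 * level k := by
  cases k with
  | zero => omega
  | succ k =>
    rw [level]
    split_ifs <;> omega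

theorem exists_inserted {w n : ℕ} (hw : 64 * (n + 1) ≤ 2 ^ w) {x : Fin n → ℝ}
    (hx : ∀ i, x i ∈ Icc (0 : ℝ) 1) (k : ℕ) (hk : k ≤ n) :
    ∃ s, bucketIndex.Inserted w x k s ∧ s.mem 0 = level k ∧
      (1 ≤ k → Stored (extend x) s.mem (level k) k) ∧
      s.time ≤ ∑ K ∈ Finset.range k, insertCost (extend x) (level K) (K + 1) ∧
      s.cells ≤ 8 * n + 16 := by
  induction k with
  | zero => exact ⟨_, rfl, rfl, by omega, by simp [State.empty], by simp [State.empty]⟩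
  | succ k ih =>
    obtain ⟨s, h1, h2, h3, h4, h5⟩ := ih (by omega)
    have hlk := level_le k
    have hX : ∀ j < k + 1, (env x (k + 1) 0 0).item j = extend x j := fun j hj => env_item x _ _ hj
    obtain ⟨s', hs', q1, q2, q3⟩ := ends_insertCmd (w := w) (e := env x (k + 1) 0 0) hw
      (K := k + 1) (m := level k) (by omega) hk (by omega)
      (fun j hj => by rw [hX j hj]; exact extend_mem hx j) (s := s.start (k + 1))
      (by simp [State.start]) (fun r hr => by simp [State.start, hr]) h2
      (fun hlt => by
        cases k with
        | zero => simp [level] at hlt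
        | succ k => exact (h3 (by omega)).congr fun j hj => (hX j (by omega)).symm) h5
    rw [insertCost_congr (by omega) hX] at q2
    have hst : Stored (extend x) s'.mem (level (k + 1)) (k + 1) := q1.congr hX
    refine ⟨s', ⟨s, h1, hs'⟩, hst.choose_spec.1.num, fun _ => hst, ?_, q3⟩
    rw [Finset.sum_range_succ]
    exact q2.trans (Nat.add_le_add_right h4 _)

theorem exists_found {w n : ℕ} (hw : 64 * (n + 1) ≤ 2 ^ w) {x : Fin n → ℝ}
    {k : ℕ} (hk : k ≤ n) {s₀ : State}
    (hst : Stored (extend x) s₀.mem (level k) k) (hc : s₀.cells ≤ 8 * n + 16) {q : ℝ}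
    (hq : q ∈ Icc (0 : ℝ) 1) :
    ∃ s, Exec w (env x k q q) bucketIndex.find (s₀.startQuery k) s ∧ s.mem = s₀.mem ∧
      ((∃ i : Fin n, (i : ℕ) < k ∧ x i = q ∧ s.out = [(i : ℕ)]) ∨
        ((∀ i : Fin n, (i : ℕ) < k → x i ≠ q) ∧ s.out = [])) ∧
      s.time ≤ 8 * (load (extend x) (level k) k (bucket (level k) q)).size + 20 ∧
      s.cells ≤ 8 * n + 16 := by
  have hX : ∀ j < k, (env x k q q).item j = extend x j := fun j hj => env_item x _ _ hj
  have hlk := level_le k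
  obtain ⟨s, hs, q1, q2, q3, q4⟩ := ends_findCmd (w := w) (e := env x k q q) hw hk
    (m := level k) (by omega) hq (s := s₀.startQuery k) (by simp [State.start, State.startQuery])
    (fun r hr => by simp [State.start, State.startQuery, hr]) rfl
    (hst.congr fun j hj => (hX j hj).symm) hc
  rw [load_congr hX] at q3
  refine ⟨s, hs, q1, ?_, q3.trans (Nat.zero_add _).le, q4⟩
  have hi : ∀ i : Fin n, extend x i = x i := fun i => by simp [extend]
  rcases q2 with ⟨j, hj, h1, h2⟩ | ⟨h1, h2⟩
  · refine .inl ⟨⟨j, by omega⟩, hj, ?_, h2⟩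
    rw [hX j hj] at h1
    rw [← hi]
    exact h1
  · refine .inr ⟨fun i hik h => h1 i hik ?_, h2⟩
    rw [hX _ hik, hi]
    exact h

theorem exists_ranged {w n : ℕ} (hw : 64 * (n + 1) ≤ 2 ^ w) {x : Fin n → ℝ}
    (hx : ∀ i, x i ∈ Icc (0 : ℝ) 1) {k : ℕ} (hk : k ≤ n) {s₀ : State}
    (hst : Stored (extend x) s₀.mem (level k) k) (hc : s₀.cells ≤ 8 * n + 16) {q q' : ℝ}
    (hq : q ∈ Icc (0 : ℝ) 1) :
    ∃ s, Exec w (env x k q q') bucketIndex.range (s₀.startQuery k) s ∧ s.mem = s₀.mem ∧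
      s.out.Nodup ∧
      (∀ j : ℕ, j ∈ s.out ↔ ∃ i : Fin n, (i : ℕ) = j ∧ j < k ∧ q ≤ x i ∧ x i ≤ q') ∧
      s.time ≤ 8 * (load (extend x) (level k) k (bucket (level k) q)).size +
        28 * s.out.length + 42 ∧
      s.cells ≤ 8 * n + 16 := by
  have hX : ∀ j < k, (env x k q q').item j = extend x j := fun j hj => env_item x _ _ hj
  have hlk := level_le k
  obtain ⟨s, hs, q1, q2, q3, q4, q5⟩ := ends_rangeCmd (w := w) (e := env x k q q') hw hk
    (m := level k) (by omega) (fun j hj => by rw [hX j hj]; exact extend_mem hx j) hq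
    (s := s₀.startQuery k) (by simp [State.start, State.startQuery])
    (fun r hr => by simp [State.start, State.startQuery, hr]) rfl
    (hst.congr fun j hj => (hX j hj).symm) hc
  rw [load_congr hX] at q4
  refine ⟨s, hs, q1, q2, fun j => ?_, q4.trans (Nat.zero_add _).le, q5⟩
  have hi : ∀ i : Fin n, extend x i = x i := fun i => by simp [extend]
  rw [q3]
  constructor
  · rintro ⟨hj, h1, h2⟩
    rw [hX j hj] at h1 h2
    refine ⟨⟨j, by omega⟩, rfl, hj, ?_, ?_⟩
    · rw [← hi]
      exact h1
    · rw [← hi]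
      exact h2
  · rintro ⟨i, rfl, hik, h1, h2⟩
    rw [hX _ hik, hi]
    exact ⟨hik, h1, h2⟩

theorem bucketIndex_correct {w n : ℕ} (hw : 64 * (n + 1) ≤ 2 ^ w) : bucketIndex.Correct w n := by
  intro x hx k hk hkn
  obtain ⟨s₀, h1, -, h3, -, h5⟩ := exists_inserted hw hx k hkn
  refine ⟨s₀, h1, fun q hq => ?_, fun q hq q' _ => ?_⟩
  · obtain ⟨s, hs, q1, q2, -⟩ := exists_found hw hkn (h3 hk) h5 hq
    exact ⟨s, hs, q1, q2⟩
  · obtain ⟨s, hs, q1, q2, q3, -⟩ := exists_ranged hw hx hkn (h3 hk) h5 (q' := q') hq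
    exact ⟨s, hs, q1, q2, q3⟩

/-! ### Costs on a fixed data set -/

theorem atEnd_le {R : State → Prop} {f : State → ℝ≥0∞} {s : State} (hs : R s) : atEnd R f ≤ f s :=
  iInf₂_le s hs

theorem insertTime_le {w n : ℕ} (hw : 64 * (n + 1) ≤ 2 ^ w) {x : Fin n → ℝ}
    (hx : ∀ i, x i ∈ Icc (0 : ℝ) 1) :
    bucketIndex.insertTime w x ≤
      ((∑ K ∈ Finset.range n, insertCost (extend x) (level K) (K + 1) : ℕ) : ℝ≥0∞) := by
  obtain ⟨s, h1, -, -, h4, -⟩ := exists_inserted hw hx n le_rfl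
  exact (atEnd_le h1).trans (by exact_mod_cast h4)

theorem queryTime_le {w n a : ℕ} (hw : 64 * (n + 1) ≤ 2 ^ w) (ha : 28 ≤ a) {x : Fin n → ℝ}
    (hx : ∀ i, x i ∈ Icc (0 : ℝ) 1) {T : ℝ≥0∞}
    (hT : ∀ k, 1 ≤ k → k ≤ n → ∀ q ∈ Icc (0 : ℝ) 1,
      ((8 * (load (extend x) (level k) k (bucket (level k) q)).size + 42 : ℕ) : ℝ≥0∞) ≤ T) :
    bucketIndex.queryTime w a x ≤ T := by
  refine iSup₂_le fun k hk => iSup₂_le fun q hq => ?_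
  obtain ⟨s₀, h1, -, h3, -, h5⟩ := exists_inserted hw hx k hk.2
  refine max_le ?_ (iSup₂_le fun q' _ => ?_)
  · obtain ⟨s, hs, -, -, q3, -⟩ := exists_found hw hk.2 (h3 hk.1) h5 hq
    refine (atEnd_le ⟨s₀, h1, hs⟩).trans (le_trans ?_ (hT k hk.1 hk.2 q hq))
    exact_mod_cast (by omega)
  · obtain ⟨s, hs, -, -, -, q4, -⟩ := exists_ranged hw hx hk.2 (h3 hk.1) h5 (q' := q') hq
    refine (atEnd_le ⟨s₀, h1, hs⟩).trans (le_trans ?_ (hT k hk.1 hk.2 q hq))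
    have := Nat.mul_le_mul_right s.out.length ha
    exact_mod_cast (by omega)

theorem space_le {w n : ℕ} (hw : 64 * (n + 1) ≤ 2 ^ w) {x : Fin n → ℝ}
    (hx : ∀ i, x i ∈ Icc (0 : ℝ) 1) :
    bucketIndex.space w x ≤ ((w * (8 * n + 16) : ℕ) : ℝ≥0∞) := by
  rw [Index.space, Nat.cast_mul]
  refine mul_le_mul_right (max_le ?_ (iSup₂_le fun k hk => iSup₂_le fun q hq => ?_)) _
  · obtain ⟨s, h1, -, -, -, h5⟩ := exists_inserted hw hx n le_rfl
    exact (atEnd_le h1).trans (by exact_mod_cast h5)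
  obtain ⟨s₀, h1, -, h3, -, h5⟩ := exists_inserted hw hx k hk.2
  refine max_le ?_ (iSup₂_le fun q' _ => ?_)
  · obtain ⟨s, hs, -, -, -, q4⟩ := exists_found hw hk.2 (h3 hk.1) h5 hq
    exact (atEnd_le ⟨s₀, h1, hs⟩).trans (by exact_mod_cast q4)
  · obtain ⟨s, hs, -, -, -, -, q5⟩ := exists_ranged hw hx hk.2 (h3 hk.1) h5 (q' := q') hq
    exact (atEnd_le ⟨s₀, h1, hs⟩).trans (by exact_mod_cast q5)

/-! ### Bounded densities -/

section density

variable {ρ₁ ρ₂ : ℝ} {χ : ProbabilityMeasure ℝ}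

theorem measure_le_of_mem (hχ : χ ∈ boundedDensityClass ρ₁ ρ₂) {S : Set ℝ}
    (hS : MeasurableSet S) :
    (χ : Measure ℝ) S ≤ ENNReal.ofReal ρ₂ * volume (S ∩ Icc (0 : ℝ) 1) := by
  obtain ⟨g, -, hg, h⟩ := hχ
  rw [h, withDensity_apply _ hS, Measure.restrict_restrict hS, ← setLIntegral_const]
  exact setLIntegral_mono' (hS.inter measurableSet_Icc) fun t ht =>
    ENNReal.ofReal_le_ofReal (hg t ht.2).2

theorem le_measure_of_mem (hχ : χ ∈ boundedDensityClass ρ₁ ρ₂) {S : Set ℝ}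
    (hS : MeasurableSet S) :
    ENNReal.ofReal ρ₁ * volume (S ∩ Icc (0 : ℝ) 1) ≤ (χ : Measure ℝ) S := by
  obtain ⟨g, -, hg, h⟩ := hχ
  rw [h, withDensity_apply _ hS, Measure.restrict_restrict hS, ← setLIntegral_const]
  exact setLIntegral_mono' (hS.inter measurableSet_Icc) fun t ht =>
    ENNReal.ofReal_le_ofReal (hg t ht.2).1

theorem ae_mem_Icc_of_mem (hχ : χ ∈ boundedDensityClass ρ₁ ρ₂) :
    ∀ᵐ t ∂(χ : Measure ℝ), t ∈ Icc (0 : ℝ) 1 := by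
  rw [ae_iff]
  have h := measure_le_of_mem hχ (S := {t | ¬ t ∈ Icc (0 : ℝ) 1}) measurableSet_Icc.compl
  have : {t | ¬ t ∈ Icc (0 : ℝ) 1} ∩ Icc (0 : ℝ) 1 = ∅ := by
    ext t
    simp
  rw [this, measure_empty, mul_zero] at h
  exact nonpos_iff_eq_zero.1 h

theorem measurable_bucket (m : ℕ) : Measurable (bucket m) :=
  Nat.measurable_floor.comp (measurable_const.mul measurable_id)

theorem measurableSet_bucket (m b : ℕ) : MeasurableSet {t | bucket m t = b} :=
  measurable_bucket m (measurableSet_singleton b)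

theorem measurableSet_buckets (m a b : ℕ) :
    MeasurableSet {t | a ≤ bucket m t ∧ bucket m t < b} :=
  measurable_bucket m (measurableSet_Ico (a := a) (b := b))

theorem measure_bucket_le (hχ : χ ∈ boundedDensityClass ρ₁ ρ₂) (hρ : 0 ≤ ρ₂) {m : ℕ}
    (hm : 1 ≤ m) (b : ℕ) :
    (χ : Measure ℝ) {t | bucket m t = b} ≤ ENNReal.ofReal (ρ₂ / m) := by
  have hm' : (0 : ℝ) < m := by exact_mod_cast hm
  refine (measure_le_of_mem hχ (measurableSet_bucket m b)).trans ?_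
  have hsub : {t | bucket m t = b} ∩ Icc (0 : ℝ) 1 ⊆ Icc (b / m : ℝ) ((b + 1) / m) := by
    rintro t ⟨ht, ht0, -⟩
    have h := (Nat.floor_eq_iff (mul_nonneg hm'.le ht0)).1 ht
    exact ⟨(div_le_iff₀' hm').2 h.1, (le_div_iff₀' hm').2 h.2.le⟩
  refine (mul_le_mul_right (measure_mono hsub) _).trans ?_
  rw [Real.volume_Icc, ← ENNReal.ofReal_mul hρ]
  refine ENNReal.ofReal_le_ofReal (le_of_eq ?_)
  field_simp
  ring

theorem le_measure_buckets (hχ : χ ∈ boundedDensityClass ρ₁ ρ₂) (hρ : 0 ≤ ρ₁) {m b r : ℕ}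
    (hm : 1 ≤ m) (hb : b ≤ m) (hr : r ≤ b) :
    ENNReal.ofReal (ρ₁ * (r / m)) ≤ (χ : Measure ℝ) {t | b - r ≤ bucket m t ∧ bucket m t < b} := by
  have hm' : (0 : ℝ) < m := by exact_mod_cast hm
  refine le_trans ?_ (le_measure_of_mem hχ (measurableSet_buckets m _ b))
  have hsub : Ico (((b - r : ℕ) : ℝ) / m) (b / m) ⊆
      {t | b - r ≤ bucket m t ∧ bucket m t < b} ∩ Icc (0 : ℝ) 1 := by
    rintro t ⟨h1, h2⟩
    have ht0 : 0 ≤ t := le_trans (by positivity) h1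
    have hbm : (b : ℝ) / m ≤ 1 := (div_le_one hm').2 (by exact_mod_cast hb)
    rw [div_le_iff₀' hm'] at h1
    have h2' := (lt_div_iff₀' hm').1 h2
    exact ⟨⟨Nat.le_floor h1, (Nat.floor_lt (mul_nonneg hm'.le ht0)).2 h2'⟩, ht0,
      h2.le.trans hbm⟩
  refine le_trans ?_ (mul_le_mul_right (measure_mono hsub) _)
  rw [Real.volume_Ico, ← ENNReal.ofReal_mul hρ]
  refine ENNReal.ofReal_le_ofReal (le_of_eq ?_)
  rw [Nat.cast_sub hr]
  ring

theorem measure_compl_buckets_le (hχ : χ ∈ boundedDensityClass ρ₁ ρ₂) (hρ : 0 ≤ ρ₁) {m b r : ℕ}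
    (hm : 1 ≤ m) (hb : b ≤ m) (hr : r ≤ b) :
    (χ : Measure ℝ) {t | b - r ≤ bucket m t ∧ bucket m t < b}ᶜ ≤
      ENNReal.ofReal (Real.exp (-(ρ₁ * (r / m)))) := by
  rw [prob_compl_eq_one_sub (measurableSet_buckets m _ b), tsub_le_iff_right]
  refine le_trans ?_ (add_le_add_right (le_measure_buckets hχ hρ hm hb hr) _)
  rw [← ENNReal.ofReal_add (Real.exp_nonneg _) (by positivity), ← ENNReal.ofReal_one]
  refine ENNReal.ofReal_le_ofReal ?_
  have := Real.add_one_le_exp (-(ρ₁ * (r / m)))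
  linarith

end density

/-! ### Expected costs -/

section expectation

variable {n : ℕ} {ρ₁ ρ₂ : ℝ} {χ : Fin n → ProbabilityMeasure ℝ}

theorem ae_mem_cube (hχ : ∀ i, χ i ∈ boundedDensityClass ρ₁ ρ₂) :
    ∀ᵐ x ∂dataLaw χ, ∀ i, x i ∈ Icc (0 : ℝ) 1 := by
  rw [ae_all_iff]
  intro i
  have h := (measurePreserving_eval (fun i => (χ i : Measure ℝ)) i).quasiMeasurePreserving
  exact h.ae (ae_mem_Icc_of_mem (hχ i))

/-- Outside the cube, which has full measure, nothing is required of the bound. -/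
theorem expectation_le (hχ : ∀ i, χ i ∈ boundedDensityClass ρ₁ ρ₂) {f h : (Fin n → ℝ) → ℝ≥0∞}
    (hh : Measurable h) (hfh : ∀ x, (∀ i, x i ∈ Icc (0 : ℝ) 1) → f x ≤ h x) :
    expectation (dataLaw χ) f ≤ ∫⁻ x, h x ∂dataLaw χ := by
  classical
  have hmem : ∀ x : Fin n → ℝ, x ∈ Set.pi univ (fun _ => Icc (0 : ℝ) 1) ↔
      ∀ i, x i ∈ Icc (0 : ℝ) 1 := fun x => by simp only [Set.mem_pi, mem_univ, true_imp_iff]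
  have hg : Measurable ((Set.pi univ fun _ : Fin n => Icc (0 : ℝ) 1).piecewise h fun _ => ⊤) :=
    hh.piecewise (MeasurableSet.univ_pi fun _ => measurableSet_Icc) measurable_const
  refine (iInf₂_le _ hg).trans (iInf_le_of_le (fun x => ?_) (le_of_eq (lintegral_congr_ae ?_)))
  · by_cases hx : ∀ i, x i ∈ Icc (0 : ℝ) 1
    · rw [Set.piecewise_eq_of_mem _ _ _ ((hmem x).2 hx)]
      exact hfh x hx
    · rw [Set.piecewise_eq_of_notMem _ _ _ (mt (hmem x).1 hx)]
      exact le_top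
  · filter_upwards [ae_mem_cube hχ] with x hx
    exact Set.piecewise_eq_of_mem _ _ _ ((hmem x).2 hx)

theorem dataLaw_box (χ : Fin n → ProbabilityMeasure ℝ) (T : Finset (Fin n)) (A : Fin n → Set ℝ) :
    dataLaw χ (Set.pi T A) = ∏ i ∈ T, (χ i : Measure ℝ) (A i) :=
  Measure.pi_pi_finset _ _ _

theorem measurable_extend (j : ℕ) : Measurable fun x : Fin n → ℝ => extend x j := by
  unfold extend
  split_ifs
  · exact measurable_pi_apply _
  · exact measurable_const

theorem extend_coe (x : Fin n → ℝ) (i : Fin n) : extend x i = x i := by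
  simp [extend]

/-- The data sets whose items `i` and `j` lie in bucket `b`. -/
def collision (n m i j b : ℕ) : Set (Fin n → ℝ) :=
  {x | bucket m (extend x i) = b ∧ bucket m (extend x j) = b}

theorem measurableSet_collision (m i j b : ℕ) : MeasurableSet (collision n m i j b) :=
  ((measurable_bucket m).comp (measurable_extend i) (measurableSet_singleton b)).inter
    ((measurable_bucket m).comp (measurable_extend j) (measurableSet_singleton b))

theorem dataLaw_collision_le (hχ : ∀ i, χ i ∈ boundedDensityClass ρ₁ ρ₂) (hρ : 0 ≤ ρ₂) {m : ℕ}
    (hm : 1 ≤ m) {i j : ℕ} (hi : i < n) (hj : j < i) (b : ℕ) :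
    dataLaw χ (collision n m i j b) ≤ ENNReal.ofReal ((ρ₂ / m) ^ 2) := by
  have hbox : collision n m i j b =
      Set.pi (({⟨i, hi⟩, ⟨j, hj.trans hi⟩} : Finset (Fin n)) : Set (Fin n))
        fun _ => {t | bucket m t = b} := by
    ext x
    simp [collision, extend, hi, hj.trans hi]
  have hne : (⟨i, hi⟩ : Fin n) ≠ ⟨j, hj.trans hi⟩ := by
    simp [Fin.ext_iff, hj.ne']
  rw [hbox, dataLaw_box, Finset.prod_pair hne, ENNReal.ofReal_pow (by positivity), sq]
  exact mul_le_mul' (measure_bucket_le (hχ _) hρ hm b) (measure_bucket_le (hχ _) hρ hm b)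

/-- The data sets whose item `i` lies in bucket `b`, while the first `i` items avoid the `r` buckets
before `b`. -/
def gap (n m i b r : ℕ) : Set (Fin n → ℝ) :=
  {x | bucket m (extend x i) = b ∧
    ∀ j < i, ¬ (b - r ≤ bucket m (extend x j) ∧ bucket m (extend x j) < b)}

theorem measurableSet_gap (m i b r : ℕ) : MeasurableSet (gap n m i b r) := by
  have h : gap n m i b r = {x | bucket m (extend x i) = b} ∩ ⋂ j, ⋂ (_ : j < i),
      {x | extend x j ∈ {t | b - r ≤ bucket m t ∧ bucket m t < b}ᶜ} := by
    ext x
    simp only [gap, mem_inter_iff, mem_iInter, mem_ofPred_eq, mem_compl_iff]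
  rw [h]
  exact ((measurable_bucket m).comp (measurable_extend i) (measurableSet_singleton b)).inter
    (MeasurableSet.iInter fun j => MeasurableSet.iInter fun _ =>
      measurable_extend j (measurableSet_buckets m _ b).compl)

theorem dataLaw_gap_le (hχ : ∀ i, χ i ∈ boundedDensityClass ρ₁ ρ₂) (hρ₁ : 0 ≤ ρ₁) (hρ₂ : 0 ≤ ρ₂)
    {m i b r : ℕ} (hm : 1 ≤ m) (hi : i < n) (hmi : m ≤ i) (hb : b ≤ m) (hr : r ≤ b) :
    dataLaw χ (gap n m i b r) ≤ ENNReal.ofReal (ρ₂ / m * Real.exp (-ρ₁) ^ r) := by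
  classical
  have hm' : (0 : ℝ) < m := by exact_mod_cast hm
  -- The event restricts each of the first `i + 1` items separately.
  have hbox : gap n m i b r ⊆
      Set.pi ((insert ⟨i, hi⟩ (Finset.Iio ⟨i, hi⟩) : Finset (Fin n)) : Set (Fin n)) fun l =>
        if l = ⟨i, hi⟩ then {t | bucket m t = b} else
          {t | b - r ≤ bucket m t ∧ bucket m t < b}ᶜ := by
    rintro x ⟨h1, h2⟩ l hl
    by_cases hli : l = ⟨i, hi⟩
    · subst hli
      beta_reduce
      rw [if_pos rfl]
      simpa [extend, hi] using h1
    · beta_reduce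
      rw [if_neg hli]
      have hlt : (l : ℕ) < i := by
        have := Finset.mem_insert.1 (Finset.mem_coe.1 hl)
        simpa [hli, Fin.lt_def] using this
      have := h2 l hlt
      rwa [extend_coe] at this
  refine (measure_mono hbox).trans ?_
  rw [dataLaw_box, Finset.prod_insert (by simp), if_pos rfl,
    ENNReal.ofReal_mul (by positivity)]
  refine mul_le_mul' (measure_bucket_le (hχ _) hρ₂ hm b) ?_
  have hle : ∀ l ∈ Finset.Iio (⟨i, hi⟩ : Fin n), (χ l : Measure ℝ)
      (if l = ⟨i, hi⟩ then {t | bucket m t = b} else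
        {t | b - r ≤ bucket m t ∧ bucket m t < b}ᶜ) ≤
      ENNReal.ofReal (Real.exp (-(ρ₁ * (r / m)))) := by
    intro l hl
    rw [if_neg (Finset.mem_Iio.1 hl).ne]
    exact measure_compl_buckets_le (hχ l) hρ₁ hm hb hr
  refine (Finset.prod_le_pow_card _ _ _ hle).trans ?_
  rw [Fin.card_Iio, ← ENNReal.ofReal_pow (Real.exp_nonneg _), ← Real.exp_nat_mul,
    ← Real.exp_nat_mul]
  refine ENNReal.ofReal_le_ofReal (Real.exp_le_exp.2 ?_)
  have h1 : (1 : ℝ) ≤ i / m := (one_le_div hm').2 (by exact_mod_cast hmi)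
  have h2 : (i : ℝ) * -(ρ₁ * (r / m)) = -((r * ρ₁) * (i / m)) := by ring
  have h3 : (r : ℝ) * ρ₁ * 1 ≤ r * ρ₁ * (i / m) := mul_le_mul_of_nonneg_left h1 (by positivity)
  rw [h2]
  linarith

open Classical in
/-- `2 ^ load` is a product of functions of the single items. -/
theorem two_pow_load (x : Fin n → ℝ) {m N : ℕ} (hN : N ≤ n) (b : ℕ) :
    (2 : ℝ≥0∞) ^ load (extend x) m N b =
      ∏ l : Fin n, (1 + if (l : ℕ) < N then {t | bucket m t = b}.indicator 1 (x l) else 0) := by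
  have hcard : load (extend x) m N b =
      (Finset.univ.filter fun l : Fin n => (l : ℕ) < N ∧ bucket m (x l) = b).card := by
    rw [load]
    refine Eq.symm (?_ : _ = _)
    refine Finset.card_bij (fun l _ => (l : ℕ)) ?_ ?_ ?_
    · intro l hl
      simpa [extend_coe] using hl
    · intro l _ l' _ h
      exact Fin.ext h
    · intro j hj
      simp only [Finset.mem_filter, Finset.mem_range] at hj
      refine ⟨⟨j, by omega⟩, ?_, rfl⟩
      have := hj.2
      simp only [Finset.mem_filter, Finset.mem_univ, true_and]
      refine ⟨hj.1, ?_⟩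
      simpa [extend, show j < n by omega] using this
  rw [hcard, ← Finset.prod_const, Finset.prod_filter]
  refine Finset.prod_congr rfl fun l _ => ?_
  by_cases h1 : (l : ℕ) < N
  · by_cases h2 : bucket m (x l) = b
    · simp [h1, h2, one_add_one_eq_two]
    · simp [h1, h2]
  · simp [h1]

theorem measurable_two_pow_load {m N : ℕ} (hN : N ≤ n) (b : ℕ) :
    Measurable fun x : Fin n → ℝ => (2 : ℝ≥0∞) ^ load (extend x) m N b := by
  simp_rw [two_pow_load _ hN]
  refine Finset.measurable_prod _ fun l _ => Measurable.const_add ?_ 1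
  split_ifs
  · exact (measurable_one.indicator (measurableSet_bucket m b)).comp (measurable_pi_apply l)
  · exact measurable_const

/-- The exponential moment of the number of items in a bucket: a product over the items, of factors
`1 + χ_l (bucket) ≤ exp (ρ₂ / m)`. -/
theorem lintegral_two_pow_load_le (hχ : ∀ i, χ i ∈ boundedDensityClass ρ₁ ρ₂) (hρ : 0 ≤ ρ₂)
    {m N : ℕ} (hm : 1 ≤ m) (hN : N ≤ n) (hNm : N ≤ 2 * m) (b : ℕ) :
    ∫⁻ x, (2 : ℝ≥0∞) ^ load (extend x) m N b ∂dataLaw χ ≤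
      ENNReal.ofReal (Real.exp (2 * ρ₂)) := by
  classical
  have hm' : (0 : ℝ) < m := by exact_mod_cast hm
  simp_rw [two_pow_load _ hN]
  have hmeas : ∀ l : Fin n, Measurable fun t : ℝ =>
      (1 + if (l : ℕ) < N then {t | bucket m t = b}.indicator 1 t else 0 : ℝ≥0∞) := by
    intro l
    refine Measurable.const_add ?_ 1
    split_ifs
    · exact measurable_one.indicator (measurableSet_bucket m b)
    · exact measurable_const
  have hindep := ProbabilityTheory.iIndepFun_pi (μ := fun l => (χ l : Measure ℝ))
    fun l => (hmeas l).aemeasurable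
  have hprod := ProbabilityTheory.lintegral_prod_eq_prod_lintegral_of_indepFun Finset.univ _ hindep
    fun l => (hmeas l).comp (measurable_pi_apply l)
  refine (le_of_eq hprod).trans ?_
  have hle : ∀ l : Fin n, ∫⁻ x : Fin n → ℝ,
      (1 + if (l : ℕ) < N then {t | bucket m t = b}.indicator 1 (x l) else 0)
        ∂Measure.pi (fun l => (χ l : Measure ℝ)) ≤
      if (l : ℕ) < N then ENNReal.ofReal (Real.exp (ρ₂ / m)) else 1 := by
    intro l
    have := (measurePreserving_eval (fun i => (χ i : Measure ℝ)) l).lintegral_comp (hmeas l)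
    refine (le_of_eq this).trans ?_
    split_ifs with h
    · rw [lintegral_add_left measurable_const, lintegral_const, measure_univ, mul_one,
        lintegral_indicator_one (measurableSet_bucket m b)]
      refine (add_le_add_right (measure_bucket_le (hχ l) hρ hm b) _).trans ?_
      rw [← ENNReal.ofReal_one, ← ENNReal.ofReal_add zero_le_one (by positivity)]
      refine ENNReal.ofReal_le_ofReal ?_
      have := Real.add_one_le_exp (ρ₂ / m)
      linarith
    · simp
  refine (Finset.prod_le_prod' fun l _ => hle l).trans ?_
  have hcard : (Finset.univ.filter fun l : Fin n => (l : ℕ) < N).card ≤ N := by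
    have := Finset.card_le_card_of_injOn (s := Finset.univ.filter fun l : Fin n => (l : ℕ) < N)
      (t := Finset.range N) (fun l => (l : ℕ)) (fun l hl => by simpa using hl)
      (fun l _ l' _ h => Fin.ext h)
    simpa using this
  rw [Finset.prod_ite, Finset.prod_const, Finset.prod_const_one, mul_one,
    ← ENNReal.ofReal_pow (Real.exp_nonneg _), ← Real.exp_nat_mul]
  refine ENNReal.ofReal_le_ofReal (Real.exp_le_exp.2 ?_)
  have h1 : ((Finset.univ.filter fun l : Fin n => (l : ℕ) < N).card : ℝ) ≤ 2 * m := by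
    exact_mod_cast hcard.trans hNm
  calc _ ≤ (2 * m : ℝ) * (ρ₂ / m) := mul_le_mul_of_nonneg_right h1 (by positivity)
    _ = 2 * ρ₂ := by field_simp

/-- A measurable bound for the number of earlier items in the bucket of item `i`. -/
noncomputable def collisions (n m i : ℕ) (x : Fin n → ℝ) : ℝ≥0∞ :=
  ∑ j ∈ Finset.range i, ∑ b ∈ Finset.range (m + 1), (collision n m i j b).indicator 1 x

theorem measurable_collisions (m i : ℕ) : Measurable (collisions n m i) :=
  Finset.measurable_sum _ fun j _ => Finset.measurable_sum _ fun b _ =>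
    measurable_one.indicator (measurableSet_collision m i j b)

theorem load_le_collisions {x : Fin n → ℝ} (hx : ∀ i, x i ∈ Icc (0 : ℝ) 1) (m i : ℕ) :
    (load (extend x) m i (bucket m (extend x i)) : ℝ≥0∞) ≤ collisions n m i x := by
  classical
  rw [load, Finset.card_filter, Nat.cast_sum, collisions]
  refine Finset.sum_le_sum fun j _ => ?_
  split_ifs with h
  · have hB : bucket m (extend x i) ∈ Finset.range (m + 1) :=
      Finset.mem_range.2 (Nat.lt_succ_of_le (bucket_le m (extend_mem hx i)))
    refine le_trans ?_ (Finset.single_le_sum (fun _ _ => zero_le) hB)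
    have : x ∈ collision n m i j (bucket m (extend x i)) := ⟨rfl, h⟩
    simp [this]
  · simp

theorem lintegral_collisions_le (hχ : ∀ i, χ i ∈ boundedDensityClass ρ₁ ρ₂) (hρ : 0 ≤ ρ₂)
    {m i : ℕ} (hm : 1 ≤ m) (hi : i < n) (him : i ≤ 2 * m) :
    ∫⁻ x, collisions n m i x ∂dataLaw χ ≤ ENNReal.ofReal (4 * ρ₂ ^ 2) := by
  have hm' : (1 : ℝ) ≤ m := by exact_mod_cast hm
  have him' : (i : ℝ) ≤ 2 * m := by exact_mod_cast him
  have hmeas : ∀ j b, Measurable ((collision n m i j b).indicator (1 : (Fin n → ℝ) → ℝ≥0∞)) :=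
    fun j b => measurable_one.indicator (measurableSet_collision m i j b)
  unfold collisions
  rw [lintegral_finsetSum _ fun j _ => Finset.measurable_sum _ fun b _ => hmeas j b]
  have hle : ∀ j ∈ Finset.range i, ∫⁻ x, ∑ b ∈ Finset.range (m + 1),
      (collision n m i j b).indicator 1 x ∂dataLaw χ ≤
      (m + 1) * ENNReal.ofReal ((ρ₂ / m) ^ 2) := by
    intro j hj
    rw [lintegral_finsetSum _ fun b _ => hmeas j b]
    refine (Finset.sum_le_card_nsmul _ _ (ENNReal.ofReal ((ρ₂ / m) ^ 2)) fun b _ => ?_).trans ?_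
    · rw [lintegral_indicator_one (measurableSet_collision m i j b)]
      exact dataLaw_collision_le hχ hρ hm hi (Finset.mem_range.1 hj) b
    · simp
  refine (Finset.sum_le_card_nsmul _ _ _ hle).trans ?_
  have h1 : ((m : ℝ≥0∞) + 1) = ENNReal.ofReal (m + 1) := by
    rw [ENNReal.ofReal_add (by positivity) zero_le_one]
    simp
  rw [Finset.card_range, nsmul_eq_mul, h1, ← ENNReal.ofReal_natCast, ← ENNReal.ofReal_mul
    (by positivity), ← ENNReal.ofReal_mul (by positivity)]
  refine ENNReal.ofReal_le_ofReal ?_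
  calc (i : ℝ) * ((m + 1) * (ρ₂ / m) ^ 2) ≤ (2 * m) * ((2 * m) * (ρ₂ / m) ^ 2) := by
        gcongr
        linarith
    _ = 4 * ρ₂ ^ 2 := by
        field_simp
        ring

/-- The zeros counted by `zeroRun L t` are those immediately before `t`. -/
theorem zeroRun_le (L : ℕ → ℕ) (t : ℕ) :
    zeroRun L t ≤ t ∧ ∀ b, t - zeroRun L t ≤ b → b < t → L b = 0 := by
  induction t with
  | zero => exact ⟨le_rfl, by omega⟩
  | succ t ih =>
    rw [zeroRun]
    split_ifs with h
    · refine ⟨by omega, fun b h1 h2 => ?_⟩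
      rcases Nat.lt_succ_iff_lt_or_eq.1 h2 with h2 | rfl
      · exact ih.2 b (by omega) h2
      · exact h
    · exact ⟨by omega, by omega⟩

/-- A measurable bound for the number of empty buckets immediately before the bucket of item `i`. -/
noncomputable def gaps (n m i : ℕ) (x : Fin n → ℝ) : ℝ≥0∞ :=
  ∑ b ∈ Finset.range (m + 1), ∑ r ∈ Finset.Ico 1 (b + 1), (gap n m i b r).indicator 1 x

theorem measurable_gaps (m i : ℕ) : Measurable (gaps n m i) :=
  Finset.measurable_sum _ fun b _ => Finset.measurable_sum _ fun r _ =>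
    measurable_one.indicator (measurableSet_gap m i b r)

theorem zeroRun_le_gaps {x : Fin n → ℝ} (hx : ∀ i, x i ∈ Icc (0 : ℝ) 1) (m i : ℕ) :
    (zeroRun (load (extend x) m i) (bucket m (extend x i)) : ℝ≥0∞) ≤ gaps n m i x := by
  classical
  set B := bucket m (extend x i) with hBd
  have hB : B ∈ Finset.range (m + 1) :=
    Finset.mem_range.2 (Nat.lt_succ_of_le (bucket_le m (extend_mem hx i)))
  obtain ⟨h1, h2⟩ := zeroRun_le (load (extend x) m i) B
  generalize zeroRun (load (extend x) m i) B = z at h1 h2 ⊢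
  unfold gaps
  refine le_trans ?_ (Finset.single_le_sum (fun _ _ => zero_le) hB)
  have hsub : Finset.Ico 1 (z + 1) ⊆ Finset.Ico 1 (B + 1) :=
    Finset.Ico_subset_Ico le_rfl (by omega)
  refine le_trans ?_ (Finset.sum_le_sum_of_subset hsub)
  have hone : ∀ r ∈ Finset.Ico 1 (z + 1),
      (gap n m i B r).indicator (1 : (Fin n → ℝ) → ℝ≥0∞) x = 1 := by
    intro r hr
    rw [Finset.mem_Ico] at hr
    refine Set.indicator_of_mem (s := gap n m i B r) ⟨rfl, fun j hj h => ?_⟩ _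
    have := h2 _ (by omega) h.2
    rw [load, Finset.card_eq_zero] at this
    exact Finset.notMem_empty j
      (this ▸ Finset.mem_filter.2 ⟨Finset.mem_range.2 hj, rfl⟩)
  rw [Finset.sum_congr rfl hone]
  simp

theorem lintegral_gaps_le (hχ : ∀ i, χ i ∈ boundedDensityClass ρ₁ ρ₂) (hρ₁ : 0 < ρ₁)
    (hρ₂ : 0 ≤ ρ₂) {m i : ℕ} (hm : 1 ≤ m) (hi : i < n) (hmi : m ≤ i) :
    ∫⁻ x, gaps n m i x ∂dataLaw χ ≤
      ENNReal.ofReal (2 * ρ₂ * (1 - Real.exp (-ρ₁))⁻¹) := by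
  have hm' : (1 : ℝ) ≤ m := by exact_mod_cast hm
  have hq : Real.exp (-ρ₁) < 1 := by simpa using hρ₁
  have hq' : 0 < 1 - Real.exp (-ρ₁) := by linarith
  have hmeas : ∀ b r, Measurable ((gap n m i b r).indicator (1 : (Fin n → ℝ) → ℝ≥0∞)) :=
    fun b r => measurable_one.indicator (measurableSet_gap m i b r)
  unfold gaps
  rw [lintegral_finsetSum _ fun b _ => Finset.measurable_sum _ fun r _ => hmeas b r]
  have hle : ∀ b ∈ Finset.range (m + 1), ∫⁻ x, ∑ r ∈ Finset.Ico 1 (b + 1),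
      (gap n m i b r).indicator 1 x ∂dataLaw χ ≤
      ENNReal.ofReal (ρ₂ / m * (1 - Real.exp (-ρ₁))⁻¹) := by
    intro b hb
    rw [Finset.mem_range] at hb
    rw [lintegral_finsetSum _ fun r _ => hmeas b r]
    have hterm : ∀ r ∈ Finset.Ico 1 (b + 1), ∫⁻ x, (gap n m i b r).indicator 1 x ∂dataLaw χ ≤
        ENNReal.ofReal (ρ₂ / m * Real.exp (-ρ₁) ^ r) := by
      intro r hr
      rw [Finset.mem_Ico] at hr
      rw [lintegral_indicator_one (measurableSet_gap m i b r)]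
      exact dataLaw_gap_le hχ hρ₁.le hρ₂ hm hi hmi (by omega) (by omega)
    refine (Finset.sum_le_sum hterm).trans ?_
    rw [← ENNReal.ofReal_sum_of_nonneg fun r _ => by positivity, ← Finset.mul_sum]
    refine ENNReal.ofReal_le_ofReal (mul_le_mul_of_nonneg_left ?_ (by positivity))
    refine (geom_sum_Ico_le_of_lt_one (Real.exp_nonneg _) hq).trans ?_
    rw [div_eq_mul_inv]
    refine mul_le_of_le_one_left (inv_nonneg.2 hq'.le) (pow_le_one₀ (Real.exp_nonneg _) hq.le)
  refine (Finset.sum_le_card_nsmul _ _ _ hle).trans ?_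
  rw [Finset.card_range, nsmul_eq_mul, ← ENNReal.ofReal_natCast, ← ENNReal.ofReal_mul
    (by positivity)]
  refine ENNReal.ofReal_le_ofReal ?_
  push_cast
  have hD := inv_nonneg.2 hq'.le
  calc ((m : ℝ) + 1) * (ρ₂ / m * (1 - Real.exp (-ρ₁))⁻¹)
      ≤ (2 * m) * (ρ₂ / m * (1 - Real.exp (-ρ₁))⁻¹) := by
        gcongr
        linarith
    _ = 2 * ρ₂ * (1 - Real.exp (-ρ₁))⁻¹ := by
        field_simp

/-- A measurable bound for the time of the insertion of item `k`. -/
noncomputable def insertBound (n k : ℕ) (x : Fin n → ℝ) : ℝ≥0∞ :=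
  if 2 * level k ≤ k + 1 then
    8 * ∑ j ∈ Finset.range (k + 1), collisions n (k + 1) j x + 60 * (k + 1 : ℕ) + 60
  else 8 * collisions n (level k) k x + 12 * gaps n (level k) k x + 60

theorem measurable_insertBound (k : ℕ) : Measurable (insertBound n k) := by
  unfold insertBound
  split_ifs
  · exact (((Finset.measurable_sum _ fun j _ => measurable_collisions _ j).const_mul 8).add_const
      _).add_const _
  · exact (((measurable_collisions _ _).const_mul 8).add
      ((measurable_gaps _ _).const_mul 12)).add_const _

theorem insertCost_le_insertBound {x : Fin n → ℝ} (hx : ∀ i, x i ∈ Icc (0 : ℝ) 1) (k : ℕ) :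
    (insertCost (extend x) (level k) (k + 1) : ℝ≥0∞) ≤ insertBound n k x := by
  unfold insertCost insertBound
  split_ifs
  · push_cast
    gcongr with j hj
    exact load_le_collisions hx _ _
  · push_cast
    gcongr
    · exact load_le_collisions hx _ _
    · exact zeroRun_le_gaps hx _ _

theorem lintegral_insertBound_le (hχ : ∀ i, χ i ∈ boundedDensityClass ρ₁ ρ₂) (hρ₁ : 0 < ρ₁)
    (hρ₂ : 0 ≤ ρ₂) {k : ℕ} (hk : k < n) :
    ∫⁻ x, insertBound n k x ∂dataLaw χ ≤ ENNReal.ofReal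
      ((32 * ρ₂ ^ 2 + 24 * (ρ₂ * (1 - Real.exp (-ρ₁))⁻¹) + 120) *
        (1 + (if 2 * level k ≤ k + 1 then k + 1 else 0 : ℕ))) := by
  have : IsProbabilityMeasure (dataLaw χ) := by
    unfold dataLaw
    infer_instance
  have hq : Real.exp (-ρ₁) < 1 := by simpa using hρ₁
  have hD : 0 ≤ ρ₂ * (1 - Real.exp (-ρ₁))⁻¹ := mul_nonneg hρ₂ (inv_nonneg.2 (by linarith))
  unfold insertBound
  split_ifs with h
  · rw [lintegral_add_right _ measurable_const, lintegral_add_right _ measurable_const,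
      lintegral_const_mul _ (Finset.measurable_sum _ fun j _ => measurable_collisions _ j),
      lintegral_finsetSum _ fun j _ => measurable_collisions _ j, lintegral_const, lintegral_const,
      measure_univ, mul_one, mul_one]
    have hle : ∀ j ∈ Finset.range (k + 1), ∫⁻ x, collisions n (k + 1) j x ∂dataLaw χ ≤
        ENNReal.ofReal (4 * ρ₂ ^ 2) := by
      intro j hj
      rw [Finset.mem_range] at hj
      exact lintegral_collisions_le hχ hρ₂ (by omega) (by omega) (by omega)
    calc _ ≤ 8 * (((k + 1 : ℕ) : ℝ≥0∞) * ENNReal.ofReal (4 * ρ₂ ^ 2)) + 60 * ((k + 1 : ℕ) : ℝ≥0∞)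
          + 60 := by
          gcongr
          refine (Finset.sum_le_card_nsmul _ _ _ hle).trans ?_
          simp
      _ = ENNReal.ofReal (8 * (((k + 1 : ℕ) : ℝ) * (4 * ρ₂ ^ 2)) + 60 * ((k + 1 : ℕ) : ℝ) + 60) := by
          rw [ENNReal.ofReal_add (by positivity) (by positivity),
            ENNReal.ofReal_add (by positivity) (by positivity),
            ENNReal.ofReal_mul (p := 8) (by positivity),
            ENNReal.ofReal_mul (p := ((k + 1 : ℕ) : ℝ)) (by positivity),
            ENNReal.ofReal_mul (p := 60) (by positivity), ENNReal.ofReal_natCast]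
          simp
      _ ≤ _ := by
          refine ENNReal.ofReal_le_ofReal ?_
          have h1 : (1 : ℝ) ≤ ((k + 1 : ℕ) : ℝ) := by
            push_cast
            linarith [Nat.cast_nonneg (α := ℝ) k]
          nlinarith [mul_nonneg hD (zero_le_one.trans h1), sq_nonneg ρ₂]
  · have hlk := level_le k
    have hl1 : k < 2 * level k := by omega
    rw [lintegral_add_right _ measurable_const, lintegral_add_left
      ((measurable_collisions _ _).const_mul 8), lintegral_const_mul _ (measurable_collisions _ _),
      lintegral_const_mul _ (measurable_gaps _ _), lintegral_const, measure_univ, mul_one]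
    calc _ ≤ 8 * ENNReal.ofReal (4 * ρ₂ ^ 2) +
          12 * ENNReal.ofReal (2 * ρ₂ * (1 - Real.exp (-ρ₁))⁻¹) + 60 := by
          gcongr
          · exact lintegral_collisions_le hχ hρ₂ (by omega) hk (by omega)
          · exact lintegral_gaps_le hχ hρ₁ hρ₂ (by omega) hk hlk
      _ = ENNReal.ofReal (8 * (4 * ρ₂ ^ 2) + 12 * (2 * ρ₂ * (1 - Real.exp (-ρ₁))⁻¹) + 60) := by
          rw [mul_assoc 2 ρ₂]
          rw [ENNReal.ofReal_add (by positivity) (by positivity),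
            ENNReal.ofReal_add (by positivity) (by positivity),
            ENNReal.ofReal_mul (p := 8) (by positivity),
            ENNReal.ofReal_mul (p := 12) (by positivity)]
          simp
      _ ≤ _ := by
          refine ENNReal.ofReal_le_ofReal ?_
          simp
          linarith

/-- Rebuilding takes linear time in total, since the number of items at least doubles. -/
theorem sum_rebuild_le (n : ℕ) :
    ∑ k ∈ Finset.range n, (if 2 * level k ≤ k + 1 then k + 1 else 0) ≤ 2 * level n := by
  induction n with
  | zero => simp
  | succ n ih =>
    rw [Finset.sum_range_succ, level]
    split_ifs <;> omega

theorem expectation_insertTime_le (hχ : ∀ i, χ i ∈ boundedDensityClass ρ₁ ρ₂) (hρ₁ : 0 < ρ₁)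
    (hρ₂ : 0 ≤ ρ₂) {w : ℕ} (hw : 64 * (n + 1) ≤ 2 ^ w) :
    expectation (dataLaw χ) (fun x => bucketIndex.insertTime w x) ≤ ENNReal.ofReal
      (3 * (32 * ρ₂ ^ 2 + 24 * (ρ₂ * (1 - Real.exp (-ρ₁))⁻¹) + 120) * n) := by
  refine (expectation_le hχ (h := fun x => ∑ k ∈ Finset.range n, insertBound n k x)
    (Finset.measurable_sum _ fun k _ => measurable_insertBound k) fun x hx => ?_).trans ?_
  · refine (insertTime_le hw hx).trans ?_
    push_cast
    exact Finset.sum_le_sum fun k _ => insertCost_le_insertBound hx k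
  · have hq : Real.exp (-ρ₁) < 1 := by simpa using hρ₁
    have hD : 0 ≤ ρ₂ * (1 - Real.exp (-ρ₁))⁻¹ := mul_nonneg hρ₂ (inv_nonneg.2 (by linarith))
    rw [lintegral_finsetSum _ fun k _ => measurable_insertBound k]
    refine (Finset.sum_le_sum fun k hk =>
      lintegral_insertBound_le hχ hρ₁ hρ₂ (Finset.mem_range.1 hk)).trans ?_
    rw [← ENNReal.ofReal_sum_of_nonneg fun k _ => by positivity, ← Finset.mul_sum,
      Finset.sum_add_distrib, ← Nat.cast_sum]
    refine ENNReal.ofReal_le_ofReal ?_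
    have h1 : ((∑ k ∈ Finset.range n, (if 2 * level k ≤ k + 1 then k + 1 else 0) : ℕ) : ℝ) ≤
        2 * n := by
      exact_mod_cast (sum_rebuild_le n).trans (Nat.mul_le_mul_left 2 (level_le n))
    rw [mul_comm 3, mul_assoc]
    refine mul_le_mul_of_nonneg_left ?_ (by positivity)
    simp only [Finset.sum_const, Finset.card_range, nsmul_eq_mul, mul_one]
    linarith

end expectation

/-! ### The bounds in terms of `log (log n)` -/

theorem one_lt_log {n : ℕ} (hn : 3 ≤ n) : 1 < Real.log n := by
  rw [Real.lt_log_iff_exp_lt (by positivity)]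
  have : (3 : ℝ) ≤ n := by exact_mod_cast hn
  linarith [Real.exp_one_lt_d9]

/-- Binary search in a list of length `L` is fast unless `2 ^ L` is much larger than `n ^ 2`. -/
theorem size_le {n : ℕ} (hn : 3 ≤ n) (L : ℕ) :
    ((8 * L.size + 42 : ℕ) : ℝ) ≤
      114 + 16 * Real.log (Real.log n) + 32 / (n : ℝ) ^ 2 * 2 ^ L := by
  have hlog := one_lt_log hn
  have hll : 0 < Real.log (Real.log n) := Real.log_pos hlog
  have hn' : (0 : ℝ) < (n : ℝ) ^ 2 := by positivity
  have hY : 0 < (2 : ℝ) ^ L / (n : ℝ) ^ 2 := by positivity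
  rw [div_mul_eq_mul_div, mul_div_assoc]
  generalize hYd : (2 : ℝ) ^ L / (n : ℝ) ^ 2 = Y at hY ⊢
  rcases Nat.eq_zero_or_pos L with rfl | hL
  · simp only [Nat.size_zero]
    push_cast
    linarith
  have h2 : (1 / 2 : ℝ) < Real.log 2 := by linarith [Real.log_two_gt_d9]
  have hL' : (0 : ℝ) < L := by exact_mod_cast hL
  -- `log t ≤ t / a + log a - 1` is used for `t = 2 ^ L`, `a = n ^ 2` and for `t = L`, `a = log n`.
  have h3 : L * Real.log 2 ≤ 2 * Real.log n + Y := by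
    have h := Real.log_le_sub_one_of_pos hY
    rw [← hYd, Real.log_div (by positivity) hn'.ne', Real.log_pow, Real.log_pow] at h
    push_cast at h
    linarith
  have h4 : Real.log L ≤ Real.log (Real.log n) + L / Real.log n := by
    have h := Real.log_le_sub_one_of_pos (div_pos hL' (zero_lt_one.trans hlog))
    rw [Real.log_div hL'.ne' (by linarith)] at h
    linarith
  have h5 : (L : ℝ) / Real.log n ≤ 4 + 2 * Y := by
    rw [div_le_iff₀ (by linarith)]
    nlinarith
  have h6 : ((L.size - 1 : ℕ) : ℝ) * Real.log 2 ≤ Real.log L := by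
    have h : 2 ^ (L.size - 1) ≤ L := by
      rw [← Nat.lt_size]
      have := Nat.size_pos.2 hL
      omega
    rw [← Real.log_pow]
    exact Real.log_le_log (by positivity) (by exact_mod_cast h)
  have h7 : (L.size : ℝ) ≤ ((L.size - 1 : ℕ) : ℝ) + 1 := by
    exact_mod_cast (by omega : L.size ≤ L.size - 1 + 1)
  have h8 : ((L.size - 1 : ℕ) : ℝ) ≤ 2 * (Real.log (Real.log n) + (4 + 2 * Y)) := by
    have : (0 : ℝ) ≤ ((L.size - 1 : ℕ) : ℝ) := Nat.cast_nonneg _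
    nlinarith
  push_cast
  linarith

section expectation

variable {n : ℕ} {ρ₁ ρ₂ : ℝ} {χ : Fin n → ProbabilityMeasure ℝ}

theorem expectation_queryTime_le (hχ : ∀ i, χ i ∈ boundedDensityClass ρ₁ ρ₂) (hρ₂ : 0 ≤ ρ₂)
    (hn : 3 ≤ n) {w a : ℕ} (hw : 64 * (n + 1) ≤ 2 ^ w) (ha : 28 ≤ a) :
    expectation (dataLaw χ) (fun x => bucketIndex.queryTime w a x) ≤ ENNReal.ofReal
      (114 + 16 * Real.log (Real.log n) + 64 * Real.exp (2 * ρ₂)) := by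
  have : IsProbabilityMeasure (dataLaw χ) := by
    unfold dataLaw
    infer_instance
  have hll : 0 < Real.log (Real.log n) := Real.log_pos (one_lt_log hn)
  have hn3 : (3 : ℝ) ≤ n := by exact_mod_cast hn
  have hmeas : ∀ k ∈ Finset.Icc 1 n, ∀ b, Measurable fun x : Fin n → ℝ =>
      (2 : ℝ≥0∞) ^ load (extend x) (level k) k b := fun k hk b =>
    measurable_two_pow_load (Finset.mem_Icc.1 hk).2 b
  have hmeas' : ∀ k ∈ Finset.Icc 1 n, Measurable fun x : Fin n → ℝ =>
      ∑ b ∈ Finset.range (n + 1), (2 : ℝ≥0∞) ^ load (extend x) (level k) k b := fun k hk =>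
    Finset.measurable_sum _ fun b _ => hmeas k hk b
  refine (expectation_le hχ (h := fun x =>
    ENNReal.ofReal (114 + 16 * Real.log (Real.log n)) + ENNReal.ofReal (32 / (n : ℝ) ^ 2) *
      ∑ k ∈ Finset.Icc 1 n, ∑ b ∈ Finset.range (n + 1),
        (2 : ℝ≥0∞) ^ load (extend x) (level k) k b) ?_ fun x hx => ?_).trans ?_
  · exact ((Finset.measurable_sum _ hmeas').const_mul _).const_add _
  · -- The term of the queried bucket is bounded by the sum over all times and buckets.
    refine queryTime_le hw ha hx fun k hk hkn q hq => ?_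
    have hb : bucket (level k) q ∈ Finset.range (n + 1) :=
      Finset.mem_range.2 (Nat.lt_succ_of_le ((bucket_le _ hq).trans ((level_le k).trans hkn)))
    generalize bucket (level k) q = b at hb ⊢
    rw [← ENNReal.ofReal_natCast]
    refine (ENNReal.ofReal_le_ofReal (size_le hn _)).trans ?_
    rw [ENNReal.ofReal_add (by positivity) (by positivity), ENNReal.ofReal_mul (by positivity),
      ENNReal.ofReal_pow zero_le_two, ENNReal.ofReal_ofNat]
    gcongr
    refine le_trans ?_ (Finset.single_le_sum (fun _ _ => zero_le) (Finset.mem_Icc.2 ⟨hk, hkn⟩))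
    exact Finset.single_le_sum (f := fun b => (2 : ℝ≥0∞) ^ load (extend x) (level k) k b)
      (fun _ _ => zero_le) hb
  · rw [lintegral_add_left measurable_const, lintegral_const, measure_univ, mul_one,
      lintegral_const_mul _ (Finset.measurable_sum _ hmeas'), lintegral_finsetSum' _
        fun k hk => (hmeas' k hk).aemeasurable]
    have hle : ∀ k ∈ Finset.Icc 1 n, ∫⁻ x, ∑ b ∈ Finset.range (n + 1),
        (2 : ℝ≥0∞) ^ load (extend x) (level k) k b ∂dataLaw χ ≤
        (n + 1 : ℕ) * ENNReal.ofReal (Real.exp (2 * ρ₂)) := by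
      intro k hk
      rw [lintegral_finsetSum' _ fun b _ => (hmeas k hk b).aemeasurable]
      rw [Finset.mem_Icc] at hk
      have hlt := lt_level hk.1
      refine (Finset.sum_le_card_nsmul _ _ _ fun b _ =>
        lintegral_two_pow_load_le hχ hρ₂ (m := level k) (by omega) hk.2 (by omega) b).trans ?_
      simp
    calc _ ≤ ENNReal.ofReal (114 + 16 * Real.log (Real.log n)) + ENNReal.ofReal (32 / (n : ℝ) ^ 2) *
          ((n : ℕ) * ((n + 1 : ℕ) * ENNReal.ofReal (Real.exp (2 * ρ₂)))) := by
          gcongr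
          refine (Finset.sum_le_card_nsmul _ _ _ hle).trans ?_
          simp
      _ = ENNReal.ofReal (114 + 16 * Real.log (Real.log n) + 32 / (n : ℝ) ^ 2 *
          (n * ((n + 1 : ℕ) * Real.exp (2 * ρ₂)))) := by
          rw [← ENNReal.ofReal_natCast, ← ENNReal.ofReal_natCast, ← ENNReal.ofReal_mul
            (by positivity), ← ENNReal.ofReal_mul (by positivity), ← ENNReal.ofReal_mul
            (by positivity), ← ENNReal.ofReal_add (by positivity) (by positivity)]
      _ ≤ _ := by
          refine ENNReal.ofReal_le_ofReal (add_le_add le_rfl ?_)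
          have h : 32 / (n : ℝ) ^ 2 * (n * ((n + 1 : ℕ) * Real.exp (2 * ρ₂))) =
              32 * ((n + 1) / n) * Real.exp (2 * ρ₂) := by
            push_cast
            field_simp
          rw [h]
          refine mul_le_mul_of_nonneg_right ?_ (Real.exp_nonneg _)
          have : ((n : ℝ) + 1) / n ≤ 2 := by
            rw [div_le_iff₀ (by linarith)]
            linarith
          linarith

theorem expectation_space_le (hχ : ∀ i, χ i ∈ boundedDensityClass ρ₁ ρ₂) (hn : 3 ≤ n) :
    expectation (dataLaw χ) (fun x => bucketIndex.space (7 * n.size) x) ≤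
      ENNReal.ofReal (300 * n * Real.log n) := by
  have : IsProbabilityMeasure (dataLaw χ) := by
    unfold dataLaw
    infer_instance
  refine (expectation_le hχ measurable_const fun x hx =>
    space_le (word_size (by omega)) hx).trans ?_
  rw [lintegral_const, measure_univ, mul_one, ← ENNReal.ofReal_natCast]
  refine ENNReal.ofReal_le_ofReal ?_
  have hlog := one_lt_log hn
  have hn3 : (3 : ℝ) ≤ n := by exact_mod_cast hn
  have h2 : (1 / 2 : ℝ) < Real.log 2 := by linarith [Real.log_two_gt_d9]
  have h6 : ((n.size - 1 : ℕ) : ℝ) * Real.log 2 ≤ Real.log n := by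
    have h : 2 ^ (n.size - 1) ≤ n := by
      rw [← Nat.lt_size]
      have := Nat.size_pos.2 (by omega : 0 < n)
      omega
    rw [← Real.log_pow]
    exact Real.log_le_log (by positivity) (by exact_mod_cast h)
  have h7 : (n.size : ℝ) ≤ ((n.size - 1 : ℕ) : ℝ) + 1 := by
    exact_mod_cast (by omega : n.size ≤ n.size - 1 + 1)
  have h8 : (n.size : ℝ) ≤ 3 * Real.log n := by
    have : (0 : ℝ) ≤ ((n.size - 1 : ℕ) : ℝ) := Nat.cast_nonneg _
    nlinarith
  push_cast
  calc 7 * (n.size : ℝ) * (8 * n + 16) ≤ 7 * (3 * Real.log n) * (14 * n) := by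
        gcongr
        linarith
    _ ≤ 300 * n * Real.log n := by
        nlinarith [mul_nonneg (zero_le_one.trans hlog.le) (Nat.cast_nonneg (α := ℝ) n)]

end expectation

/-- A bound `A + B log log n` is a bound `C log log n`, since `n ≥ 3`. -/
theorem le_mul_loglog {A B C : ℝ} (hA : 0 ≤ A) (hC : A / Real.log (Real.log 3) + B ≤ C) {n : ℕ}
    (hn : 3 ≤ n) {D : ℝ} (hD : 0 ≤ D) (hC0 : 0 ≤ C) :
    A + B * Real.log (Real.log n) ≤ C * (Real.log (Real.log n) + D) := by
  have h3 : 1 < Real.log 3 := by exact_mod_cast one_lt_log (n := 3) le_rfl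
  have hl3 : 0 < Real.log (Real.log 3) := Real.log_pos h3
  have hle : Real.log (Real.log 3) ≤ Real.log (Real.log n) :=
    Real.log_le_log (by linarith) (Real.log_le_log (by norm_num) (by exact_mod_cast hn))
  have h1 : A ≤ A / Real.log (Real.log 3) * Real.log (Real.log n) := by
    rw [div_mul_eq_mul_div, le_div_iff₀ hl3]
    exact mul_le_mul_of_nonneg_left hle hA
  have h2 := mul_le_mul_of_nonneg_right hC (hl3.le.trans hle)
  have h4 := mul_nonneg hC0 hD
  nlinarith

end LearnedIndex

theorem mainTheorem10 :
    ∃ C₀ : ℝ, 0 < C₀ ∧ ∀ ρ₁ ρ₂ : ℝ, 0 < ρ₁ → ρ₁ ≤ ρ₂ →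
      ∃ (I : LearnedIndex.Index) (c C : ℕ), 0 < c ∧
        (∀ n : ℕ, 1 ≤ n → I.Correct (c * n.size) n) ∧
        ∀ n : ℕ, 3 ≤ n → ∀ (δ : ℝ) (χ : Fin n → ProbabilityMeasure ℝ),
          (∀ i, χ i ∈ LearnedIndex.boundedDensityClass ρ₁ ρ₂) → LearnedIndex.shift χ ≤ δ →
            LearnedIndex.expectation (LearnedIndex.dataLaw χ)
                (fun x => I.insertTime (c * n.size) x) / (n : ℝ≥0∞)
              ≤ ENNReal.ofReal (C * (Real.log (Real.log n) + Real.posLog (δ * √(n : ℝ)))) ∧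
            LearnedIndex.expectation (LearnedIndex.dataLaw χ)
                (fun x => I.queryTime (c * n.size) C x)
              ≤ ENNReal.ofReal (C * (Real.log (Real.log n) + Real.posLog (δ * √(n : ℝ)))) ∧
            LearnedIndex.expectation (LearnedIndex.dataLaw χ)
                (fun x => I.space (c * n.size) x)
              ≤ ENNReal.ofReal (C₀ * (ρ₂ / ρ₁) * n * Real.log n) := by
  refine ⟨300, by norm_num, fun ρ₁ ρ₂ hρ₁ hρ => ?_⟩
  have hρ₂ : 0 < ρ₂ := hρ₁.trans_le hρ
  have hq : Real.exp (-ρ₁) < 1 := by simpa using hρ₁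
  have hD : 0 ≤ ρ₂ * (1 - Real.exp (-ρ₁))⁻¹ := mul_nonneg hρ₂.le (inv_nonneg.2 (by linarith))
  obtain ⟨C₁, hC₁⟩ := exists_nat_ge
    (3 * (32 * ρ₂ ^ 2 + 24 * (ρ₂ * (1 - Real.exp (-ρ₁))⁻¹) + 120) / Real.log (Real.log 3) + 0)
  obtain ⟨C₂, hC₂⟩ := exists_nat_ge
    ((114 + 64 * Real.exp (2 * ρ₂)) / Real.log (Real.log 3) + 16)
  refine ⟨LearnedIndex.bucketIndex, 7, max 28 (max C₁ C₂), by norm_num,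
    fun n hn => LearnedIndex.bucketIndex_correct (LearnedIndex.word_size hn),
    fun n hn δ χ hχ _ => ⟨?_, ?_, ?_⟩⟩
  · have hn0 : (n : ℝ) ≠ 0 := by
      have : n ≠ 0 := by omega
      exact_mod_cast this
    refine ENNReal.div_le_of_le_mul ?_
    refine (LearnedIndex.expectation_insertTime_le hχ hρ₁ hρ₂.le
      (LearnedIndex.word_size (by omega))).trans ?_
    rw [ENNReal.ofReal_mul (by positivity), ENNReal.ofReal_natCast]
    have h := LearnedIndex.le_mul_loglog (by positivity)
      (hC₁.trans (Nat.cast_le.2 ((le_max_left C₁ C₂).trans (le_max_right 28 _)))) hn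
      (Real.posLog_nonneg (x := δ * √(n : ℝ))) (Nat.cast_nonneg _)
    rw [zero_mul, add_zero] at h
    exact mul_le_mul_left (ENNReal.ofReal_le_ofReal h) _
  · refine (LearnedIndex.expectation_queryTime_le hχ hρ₂.le hn (LearnedIndex.word_size (by omega))
      (le_max_left _ _)).trans (ENNReal.ofReal_le_ofReal ?_)
    have h := LearnedIndex.le_mul_loglog (by positivity)
      (hC₂.trans (Nat.cast_le.2 ((le_max_right C₁ C₂).trans (le_max_right 28 _)))) hn
      (Real.posLog_nonneg (x := δ * √(n : ℝ))) (Nat.cast_nonneg _)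
    linarith
  · refine (LearnedIndex.expectation_space_le hχ hn).trans (ENNReal.ofReal_le_ofReal ?_)
    have h1 : 1 ≤ ρ₂ / ρ₁ := (one_le_div hρ₁).2 hρ
    have h2 : 0 ≤ Real.log n := (zero_le_one.trans (LearnedIndex.one_lt_log hn).le)
    have h3 : (300 : ℝ) * 1 ≤ 300 * (ρ₂ / ρ₁) := by linarith
    have h4 : (300 : ℝ) * 1 * n ≤ 300 * (ρ₂ / ρ₁) * n :=
      mul_le_mul_of_nonneg_right h3 (Nat.cast_nonneg n)
    have h5 := mul_le_mul_of_nonneg_right h4 h2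
    rwa [mul_one] at h5
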